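/- Let $\mathbb{K}=\mathbb{R}$ or $\mathbb{K}=\mathbb{C}$, let $2<p<6$ and $\alpha<0$. For $u\in H^1(\mathbb{R}^+)=H^1((0,+\infty);\mathbb{K})$, identified with its representative that is continuous on $[0,+\infty)$, let $$F(u)=\frac12\int_0^{+\infty}|u'|^2\,dx-\frac1p\int_0^{+\infty}|u|^p\,dx+\frac{\alpha}{2}|u(0)|^2,$$ and for $\mu>0$ let $$H^1_\mu(\mathbb{R}^+)=\Big\{u\in H^1(\mathbb{R}^+)\,:\,\int_0^{+\infty}|u|^2\,dx=\mu\Big\}.$$ A ground state at mass $\mu$ is a function $u\in H^1_\mu(\mathbb{R}^+)$ with $F(u)\le F(v)$ for all $v\in H^1_\mu(\mathbb{R}^+)$. Then, for every $\mu>0$, there exists a ground state at mass $\mu$ that is real-valued and positive on $[0,+\infty)$, and it is unique: every ground state at mass $\mu$ that is real-valued and positive on $(0,+\infty)$ coincides with it on $[0,+\infty)$. -/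

import Mathlib

open MeasureTheory Set
open scoped ContDiff ENNReal

namespace HalfLineNLS

/-- Lebesgue measure on the half-line `ℝ⁺ = (0, +∞)`. -/
noncomputable abbrev halfLine : Measure ℝ := volume.restrict (Ioi (0 : ℝ))

/-- `g` is a distributional derivative of `u` on `(0, +∞)`: integration by parts holds against
every smooth real test function with compact support contained in `(0, +∞)`. -/
def IsWeakDeriv {𝕜 : Type*} [RCLike 𝕜] (u g : ℝ → 𝕜) : Prop :=
  ∀ φ : ℝ → ℝ, ContDiff ℝ ∞ φ → HasCompactSupport φ → tsupport φ ⊆ Ioi (0 : ℝ) →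
    ∫ x, deriv φ x • u x ∂halfLine = -∫ x, φ x • g x ∂halfLine

/-- `g` is a square-integrable weak derivative of `u` on `(0, +∞)`. -/
def IsL2WeakDeriv {𝕜 : Type*} [RCLike 𝕜] (u g : ℝ → 𝕜) : Prop :=
  MemLp g 2 halfLine ∧ IsWeakDeriv u g

/-- `u` belongs to `H¹(ℝ⁺)`: it is square integrable with a square-integrable weak derivative.
Every class in `H¹(ℝ⁺)` has exactly one representative that is continuous on `[0, +∞)`; as usual
in dimension one this representative is the one used, so that `u 0` is the trace of `u` at the
origin. The values of `u` on `(-∞, 0)` are irrelevant. -/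
structure MemH1 {𝕜 : Type*} [RCLike 𝕜] (u : ℝ → 𝕜) : Prop where
  continuousOn : ContinuousOn u (Ici (0 : ℝ))
  memLp : MemLp u 2 halfLine
  exists_weakDeriv : ∃ g : ℝ → 𝕜, IsL2WeakDeriv u g

/-- The weak derivative `u'` of a function of `H¹(ℝ⁺)`, well defined almost everywhere on
`(0, +∞)` by `IsL2WeakDeriv.ae_eq`. -/
noncomputable def weakDeriv {𝕜 : Type*} [RCLike 𝕜] (u : ℝ → 𝕜) : ℝ → 𝕜 :=
  Classical.epsilon (IsL2WeakDeriv u)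

theorem MemH1.isL2WeakDeriv {𝕜 : Type*} [RCLike 𝕜] {u : ℝ → 𝕜} (hu : MemH1 u) :
    IsL2WeakDeriv u (weakDeriv u) :=
  Classical.epsilon_spec hu.exists_weakDeriv

theorem IsL2WeakDeriv.ae_eq {𝕜 : Type*} [RCLike 𝕜] {u g h : ℝ → 𝕜}
    (hg : IsL2WeakDeriv u g) (hh : IsL2WeakDeriv u h) : g =ᵐ[halfLine] h := by
  have hgl : LocallyIntegrable g halfLine := hg.1.locallyIntegrable (by norm_num)
  have hhl : LocallyIntegrable h halfLine := hh.1.locallyIntegrable (by norm_num)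
  have key : ∀ᵐ x ∂volume, x ∈ Ioi (0 : ℝ) → g x - h x = 0 := by
    refine isOpen_Ioi.ae_eq_zero_of_integral_contDiff_smul_eq_zero (f := fun x => g x - h x) ?_ ?_
    · exact locallyIntegrableOn_of_locallyIntegrable_restrict (hgl.sub hhl)
    · intro φ hφ hc hsupp
      have hφg : Integrable (fun x => φ x • g x) halfLine :=
        hgl.integrable_smul_left_of_hasCompactSupport hφ.continuous hc
      have hφh : Integrable (fun x => φ x • h x) halfLine :=
        hhl.integrable_smul_left_of_hasCompactSupport hφ.continuous hc
      have h1 := hg.2 φ hφ hc hsupp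
      have h2 := hh.2 φ hφ hc hsupp
      have hzero : ∀ x, x ∉ Ioi (0 : ℝ) → φ x • (g x - h x) = 0 := by
        intro x hx
        rw [image_eq_zero_of_notMem_tsupport (fun hx' => hx (hsupp hx')), zero_smul]
      rw [← setIntegral_eq_integral_of_forall_compl_eq_zero hzero]
      simp only [smul_sub]
      rw [integral_sub hφg hφh, sub_eq_zero]
      exact neg_injective (h1.symm.trans h2)
  rw [Filter.EventuallyEq, ae_restrict_iff' measurableSet_Ioi]
  filter_upwards [key] with x hx hx0
  exact sub_eq_zero.mp (hx hx0)

/-- The mass-constrained space `H¹_μ(ℝ⁺)`. -/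
def H1mass (𝕜 : Type*) [RCLike 𝕜] (μ : ℝ) : Set (ℝ → 𝕜) :=
  {u | MemH1 u ∧ ∫ x, ‖u x‖ ^ 2 ∂halfLine = μ}

/-- The energy
`F(u) = ½ ∫₀^∞ |u'|² dx - (1/p) ∫₀^∞ |u|ᵖ dx + (α/2) |u(0)|²`. -/
noncomputable def energy {𝕜 : Type*} [RCLike 𝕜] (p α : ℝ) (u : ℝ → 𝕜) : ℝ :=
  1 / 2 * (∫ x, ‖weakDeriv u x‖ ^ 2 ∂halfLine) - 1 / p * (∫ x, ‖u x‖ ^ p ∂halfLine)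
    + α / 2 * ‖u 0‖ ^ 2

/-- A ground state at mass `μ` is a global minimizer of the energy on `H¹_μ(ℝ⁺)`. -/
def IsGroundState {𝕜 : Type*} [RCLike 𝕜] (p α μ : ℝ) (u : ℝ → 𝕜) : Prop :=
  u ∈ H1mass 𝕜 μ ∧ IsMinOn (energy p α) (H1mass 𝕜 μ) u

/-- `u` takes only positive real values on `s`. -/
def PositiveOn {𝕜 : Type*} [RCLike 𝕜] (u : ℝ → 𝕜) (s : Set ℝ) : Prop :=
  ∀ x ∈ s, ∃ r : ℝ, 0 < r ∧ u x = (r : 𝕜)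

end HalfLineNLS

/-!
The proof is a calibration argument in mass coordinates; no compactness is needed.

Let `N = |v|²` and let `m(x) = ∫ₓ^∞ N` be the mass to the right of `x`. If `x` is replaced by `m` as
the independent variable and `N²` is taken as the unknown, the energy becomes convex: with
`r = (p - 2) / 2`, the potential term is `-(N²)^(r/2)` with `r / 2 < 1` because `p < 6`, the boundary
term is `α/2 (N(0)²)^(1/2)` with `α < 0`, and the kinetic term is `⅛ ∫ (dN/dm)² dm`, which is convex
in `N²`. A positive critical point is therefore a minimizer, and the only positive one.

In these coordinates the critical point is the function `h` with `h(0) = 0` and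
`h' = 2 √(α² + (2/p) (Zʳ - hʳ))`, where `Z` is chosen such that `h(μ) = Z`
(`exists_isTailProfile`). The convexity inequality is made explicit by completing a square: for
`k = h'/h`, an arbitrary `v` satisfies
`½ |v'|² - |v|ᵖ/p = ½ |v' + ½ N k(m) v|² + (N/p) Y(N, h(m))
  - d/dx [⅛ N² k(m) - (1/p)(1 - r/2) ∫₀^m hʳ]`,
where `Y ≥ 0` is the defect in Young's inequality and vanishes only if `N = h(m)`
(`youngDefect_nonneg`, `eq_of_youngDefect_eq_zero`). The boundary contribution at `0` is
`-α/(4Z) (N(0) - Z)²` up to a constant. The one at infinity is harmless because `k(m) ≤ 1/m` by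
concavity of `h`, while `N(x)² ≤ 4 m(x) ∫ₓ^∞ |v'|²`. This gives `IsDensity.energy_lower_bound`, whose
right side is attained by the explicit soliton (`IsTailProfile.soliton_energy`).

If equality holds and `v > 0`, then `N = h(m)`, i.e. `m' = -h(m)` with `m(0) = μ`, and uniqueness for
this Lipschitz equation identifies `|v|²` with the soliton density. The weak derivative enters only
through the fact that a function of `H¹(ℝ⁺)` is the integral of it (`eq_add_integral_of_isWeakDeriv`,
from the du Bois-Reymond lemma).
-/

open MeasureTheory Set
open scoped ContDiff ENNReal

namespace HalfLineNLS

/-! ### Functions with a weak derivative on the half-line -/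

theorem exists_Icc_of_isCompact_subset_Ioi {K : Set ℝ} (hK : IsCompact K) (h : K ⊆ Ioi 0) :
    ∃ a b : ℝ, 0 < a ∧ a ≤ b ∧ K ⊆ Icc a b := by
  have hK' : IsCompact (insert 1 K) := hK.insert 1
  obtain ⟨a, ha⟩ := hK'.exists_isLeast (insert_nonempty _ _)
  obtain ⟨b, hb⟩ := hK'.exists_isGreatest (insert_nonempty _ _)
  refine ⟨a, b, ?_, ha.2 hb.1, fun x hx => ⟨ha.2 (Or.inr hx), hb.2 (Or.inr hx)⟩⟩
  rcases ha.1 with rfl | h'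
  · exact one_pos
  · exact h h'

/-- A test function on `(0, ∞)` with vanishing integral is the derivative of a test function. -/
theorem exists_testFunction_deriv_eq {ψ : ℝ → ℝ} (hψ : ContDiff ℝ ∞ ψ)
    (hc : HasCompactSupport ψ) (hs : tsupport ψ ⊆ Ioi 0) (h0 : ∫ x, ψ x = 0) :
    ∃ φ : ℝ → ℝ, ContDiff ℝ ∞ φ ∧ HasCompactSupport φ ∧ tsupport φ ⊆ Ioi 0 ∧ deriv φ = ψ := by
  obtain ⟨a, b, ha, hab, hK⟩ := exists_Icc_of_isCompact_subset_Ioi hc hs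
  have hd : ∀ x, HasDerivAt (fun x => ∫ t in a..x, ψ t) (ψ x) x := fun x =>
    intervalIntegral.integral_hasDerivAt_right (hψ.continuous.intervalIntegrable _ _)
      (hψ.continuous.stronglyMeasurableAtFilter _ _) hψ.continuous.continuousAt
  have hderiv : deriv (fun x => ∫ t in a..x, ψ t) = ψ := funext fun x => (hd x).deriv
  have hout : ∀ x, x ∉ Icc a b → ψ x = 0 := fun x hx =>
    image_eq_zero_of_notMem_tsupport fun h => hx (hK h)
  have hsub : Function.support (fun x => ∫ t in a..x, ψ t) ⊆ Icc a b := by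
    intro x hx
    by_contra hxn
    refine hx ?_
    rcases lt_or_ge x a with hxa | hxa
    · show ∫ t in a..x, ψ t = 0
      rw [intervalIntegral.integral_symm, neg_eq_zero, intervalIntegral.integral_of_le hxa.le,
        integral_Ioc_eq_integral_Ioo]
      exact setIntegral_eq_zero_of_forall_eq_zero fun t ht => hout t fun h =>
        absurd h.1 (not_le.2 ht.2)
    · have hbx : b < x := by
        by_contra hbx
        exact hxn ⟨hxa, not_lt.1 hbx⟩
      show ∫ t in a..x, ψ t = 0
      rw [intervalIntegral.integral_of_le hxa, ← integral_Icc_eq_integral_Ioc,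
        setIntegral_eq_integral_of_forall_compl_eq_zero, h0]
      exact fun t ht => hout t fun h => ht ⟨h.1, h.2.trans hbx.le⟩
  have hts : tsupport (fun x => ∫ t in a..x, ψ t) ⊆ Icc a b :=
    closure_minimal hsub isClosed_Icc
  refine ⟨fun x => ∫ t in a..x, ψ t, ?_, ?_, ?_, hderiv⟩
  · rw [contDiff_infty_iff_deriv, hderiv]
    exact ⟨fun x => (hd x).differentiableAt, hψ⟩
  · exact isCompact_Icc.of_isClosed_subset (isClosed_tsupport _) hts
  · exact fun x hx => lt_of_lt_of_le ha (hts hx).1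

/-- **du Bois-Reymond lemma**: a continuous function whose distributional derivative on `(0, ∞)`
vanishes is constant there. -/
theorem exists_const_of_integral_deriv_mul_eq_zero {w : ℝ → ℝ} (hw : Continuous w)
    (h : ∀ φ : ℝ → ℝ, ContDiff ℝ ∞ φ → HasCompactSupport φ → tsupport φ ⊆ Ioi 0 →
      ∫ x, deriv φ x * w x = 0) : ∃ c, ∀ x ∈ Ioi (0 : ℝ), w x = c := by
  -- a test function of integral one, to correct the mean of an arbitrary test function
  let χ₀ : ContDiffBump (2 : ℝ) := ⟨1 / 2, 1, by norm_num, by norm_num⟩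
  obtain ⟨χ, hχ, hχc, hχs, hχ1⟩ : ∃ χ : ℝ → ℝ, ContDiff ℝ ∞ χ ∧ HasCompactSupport χ ∧
      tsupport χ ⊆ Ioi 0 ∧ ∫ x, χ x = 1 := by
    refine ⟨χ₀.normed volume, χ₀.contDiff_normed, χ₀.hasCompactSupport_normed, ?_,
      χ₀.integral_normed⟩
    rw [χ₀.tsupport_normed_eq]
    intro x hx
    have hx' : |x - 2| ≤ 1 := by simpa [χ₀, Real.dist_eq] using hx
    have := (abs_le.1 hx').1
    show (0 : ℝ) < x
    linarith
  set c : ℝ := ∫ x, χ x * w x with hcdef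
  have hint : ∀ φ : ℝ → ℝ, ContDiff ℝ ∞ φ → HasCompactSupport φ →
      Integrable (fun x => φ x * w x) := fun φ h1 h2 =>
    (h1.continuous.mul hw).integrable_of_hasCompactSupport h2.mul_right
  have key : ∀ᵐ x ∂volume, x ∈ Ioi (0 : ℝ) → w x - c = 0 := by
    refine isOpen_Ioi.ae_eq_zero_of_integral_contDiff_smul_eq_zero (f := fun x => w x - c) ?_ ?_
    · exact (hw.sub continuous_const).locallyIntegrable.locallyIntegrableOn _
    · intro ψ hψ hψc hψs
      set I : ℝ := ∫ x, ψ x with hI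
      have hψi : Integrable ψ := hψ.continuous.integrable_of_hasCompactSupport hψc
      have hχi : Integrable χ := hχ.continuous.integrable_of_hasCompactSupport hχc
      have hηc : HasCompactSupport fun x => I * χ x := hχc.mul_left
      obtain ⟨φ, hφ, hφc, hφs, hφd⟩ := exists_testFunction_deriv_eq
        (ψ := fun x => ψ x - I * χ x) (hψ.sub (contDiff_const.mul hχ))
        (hψc.sub hηc)
        (by
          refine (tsupport_sub ψ fun x => I * χ x).trans (union_subset hψs ?_)
          exact (tsupport_mul_subset_right).trans hχs)
        (by rw [integral_sub hψi (hχi.const_mul I), integral_const_mul, hχ1]; simp [hI])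
      have h1 := h φ hφ hφc hφs
      rw [hφd] at h1
      have h2 : ∫ x, (ψ x - I * χ x) * w x = (∫ x, ψ x * w x) - I * c := by
        rw [hcdef, ← integral_const_mul, ← integral_sub (hint ψ hψ hψc)
          ((hint χ hχ hχc).const_mul I)]
        exact integral_congr_ae (Filter.Eventually.of_forall fun x => by ring)
      have h3 : ∫ x, ψ x • (w x - c) = (∫ x, ψ x * w x) - I * c := by
        rw [hI, ← integral_mul_const, ← integral_sub (hint ψ hψ hψc) (hψi.mul_const c)]
        exact integral_congr_ae (Filter.Eventually.of_forall fun x => by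
          simp only [smul_eq_mul]; ring)
      rw [h3, ← h2, h1]
  refine ⟨c, fun x hx => ?_⟩
  have hae : w =ᵐ[volume.restrict (Ioi 0)] fun _ => c := by
    rw [Filter.EventuallyEq, ae_restrict_iff' measurableSet_Ioi]
    filter_upwards [key] with x hx hx0
    exact sub_eq_zero.1 (hx hx0)
  exact Measure.eqOn_open_of_ae_eq hae isOpen_Ioi hw.continuousOn continuousOn_const hx

/-- A real function that is continuous on `[0, ∞)` is the integral of its weak derivative. -/
theorem eq_add_integral_of_isWeakDeriv {f g : ℝ → ℝ} (hf : ContinuousOn f (Ici 0))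
    (hg : ∀ b, IntervalIntegrable g volume 0 b)
    (h : ∀ φ : ℝ → ℝ, ContDiff ℝ ∞ φ → HasCompactSupport φ → tsupport φ ⊆ Ioi 0 →
      ∫ x in Ioi 0, deriv φ x * f x = -∫ x in Ioi 0, φ x * g x) {x : ℝ} (hx : 0 ≤ x) :
    f x = f 0 + ∫ t in 0..x, g t := by
  have hGc : Continuous fun x => ∫ t in (0 : ℝ)..x, g t :=
    intervalIntegral.continuous_primitive
      (fun a b => (hg a).symm.trans (hg b)) 0
  have hfc : Continuous fun x => f (max x 0) :=
    hf.comp_continuous (by fun_prop) fun x => le_max_right x 0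
  obtain ⟨c, hc⟩ := exists_const_of_integral_deriv_mul_eq_zero
      (w := fun x => f (max x 0) - ∫ t in (0 : ℝ)..x, g t) (hfc.sub hGc) fun φ hφ hφc hφs => by
    obtain ⟨a, b, ha, hab, hK⟩ := exists_Icc_of_isCompact_subset_Ioi hφc hφs
    have h0b : (0 : ℝ) ≤ b + 1 := by linarith
    have hφ0 : ∀ x, x ∉ Icc a b → φ x = 0 := fun x hx =>
      image_eq_zero_of_notMem_tsupport fun h => hx (hK h)
    have hdφ0 : ∀ x, x ∉ Icc a b → deriv φ x = 0 := fun x hx =>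
      image_eq_zero_of_notMem_tsupport fun h => hx (hK (tsupport_deriv_subset h))
    have hdφ : Continuous (deriv φ) := hφ.continuous_deriv (by simp)
    -- integration by parts for the absolutely continuous primitive of `g`
    have hGac : AbsolutelyContinuousOnInterval (fun x => ∫ t in (0 : ℝ)..x, g t) 0 (b + 1) :=
      (hg _).absolutelyContinuousOnInterval_intervalIntegral (by simp)
    have hφac : AbsolutelyContinuousOnInterval φ 0 (b + 1) :=
      (hφ.of_le (by simp)).contDiffOn.absolutelyContinuousOnInterval
    have hparts := hφac.integral_mul_deriv_eq_deriv_mul hGac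
    rw [hφ0 0 (fun h => absurd h.1 (not_le.2 ha)), hφ0 (b + 1) (fun h => by linarith [h.2])]
      at hparts
    have hparts' : ∫ x in (0 : ℝ)..(b + 1), φ x * g x =
        -∫ x in (0 : ℝ)..(b + 1), deriv φ x * ∫ t in (0 : ℝ)..x, g t := by
      have : ∫ x in (0 : ℝ)..(b + 1), φ x * g x =
          ∫ x in (0 : ℝ)..(b + 1), φ x * deriv (fun x => ∫ t in (0 : ℝ)..x, g t) x := by
        refine intervalIntegral.integral_congr_ae ?_
        filter_upwards [(hg (b + 1)).ae_hasDerivAt_integral] with x hx hxm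
        rw [(hx (uIoc_subset_uIcc hxm) 0 (by simp)).deriv]
      rw [this, hparts]
      ring
    have hext : ∀ F : ℝ → ℝ, (∀ x, x ∉ Icc a b → F x = 0) →
        ∫ x in (0 : ℝ)..(b + 1), F x = ∫ x, F x := by
      intro F hF
      rw [intervalIntegral.integral_of_le h0b]
      refine setIntegral_eq_integral_of_forall_compl_eq_zero fun x hx => hF x fun h => hx ?_
      exact ⟨lt_of_lt_of_le ha h.1, by linarith [h.2]⟩
    have hext' : ∀ F : ℝ → ℝ, (∀ x, x ∉ Icc a b → F x = 0) →
        ∫ x in Ioi (0 : ℝ), F x = ∫ x, F x := by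
      intro F hF
      refine setIntegral_eq_integral_of_forall_compl_eq_zero fun x hx => hF x fun h => hx ?_
      exact lt_of_lt_of_le ha h.1
    rw [hext (fun x => φ x * g x) (fun x hx => by simp [hφ0 x hx]),
      hext (fun x => deriv φ x * ∫ t in (0 : ℝ)..x, g t) (fun x hx => by simp [hdφ0 x hx])]
      at hparts'
    have hw := h φ hφ hφc hφs
    rw [hext' (fun x => deriv φ x * f x) (fun x hx => by simp [hdφ0 x hx]),
      hext' (fun x => φ x * g x) (fun x hx => by simp [hφ0 x hx]), hparts', neg_neg] at hw
    have hfeq : ∫ x, deriv φ x * f x = ∫ x, deriv φ x * f (max x 0) := by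
      refine integral_congr_ae (Filter.Eventually.of_forall fun x => ?_)
      by_cases hx : x ∈ Icc a b
      · simp only [max_eq_left (ha.le.trans hx.1)]
      · simp [hdφ0 x hx]
    have hi : ∀ F : ℝ → ℝ, Continuous F → Integrable fun x => deriv φ x * F x := fun F hF =>
      (hdφ.mul hF).integrable_of_hasCompactSupport hφc.deriv.mul_right
    simp only [mul_sub]
    rw [integral_sub (hi _ hfc) (hi _ hGc), ← hfeq, hw, sub_self]
  have hconst : ∀ y ∈ Ici (0 : ℝ), f (max y 0) - (∫ t in (0 : ℝ)..y, g t) = c := by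
    have hcl : IsClosed {y : ℝ | f (max y 0) - (∫ t in (0 : ℝ)..y, g t) = c} :=
      isClosed_eq (hfc.sub hGc) continuous_const
    rw [← closure_Ioi (0 : ℝ)]
    exact closure_minimal hc hcl
  have h1 := hconst x hx
  have h2 := hconst 0 self_mem_Ici
  simp only [max_eq_left hx, max_self, intervalIntegral.integral_same, sub_zero] at h1 h2
  linarith

/-! ### The density of a function of `H¹(ℝ⁺)` -/

/-- The data that the energy bound needs from a function `v ∈ H¹(ℝ⁺)`: `N` stands for `|v|²`
(extended continuously to the whole line), `n` for its derivative `2 Re (v̄ v')` and `D` for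
`|v'|²`. The inequality `quadratic` says that `|v' + c v|² ≥ 0` for every real `c`. -/
structure IsDensity (N n D : ℝ → ℝ) : Prop where
  continuous : Continuous N
  nonneg : ∀ x, 0 ≤ N x
  integrable : IntegrableOn N (Ioi 0)
  absolutelyContinuous : ∀ b, 0 ≤ b → AbsolutelyContinuousOnInterval N 0 b
  hasDerivAt : ∀ᵐ x, 0 < x → HasDerivAt N (n x) x
  integrable_deriv : IntegrableOn D (Ioi 0)
  deriv_nonneg : ∀ x, 0 ≤ D x
  quadratic : ∀ x, 0 < x → ∀ c : ℝ, 0 ≤ D x + c * n x + c ^ 2 * N x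

/-- A continuous real-linear functional `L` turns a function of `H¹(ℝ⁺)` into a primitive of
`L` of its weak derivative. -/
theorem MemH1.clm_comp_eq {𝕜 : Type*} [RCLike 𝕜] {v : ℝ → 𝕜} (hv : MemH1 v) (L : 𝕜 →L[ℝ] ℝ) :
    (∀ b, IntervalIntegrable ((Ioi 0).indicator fun x => L (weakDeriv v x)) volume 0 b) ∧
    ∀ x, 0 ≤ x →
      L (v x) = L (v 0) + ∫ t in 0..x, (Ioi 0).indicator (fun x => L (weakDeriv v x)) t := by
  obtain ⟨hd2, hd⟩ := hv.isL2WeakDeriv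
  have hdl : LocallyIntegrable (weakDeriv v) halfLine := hd2.locallyIntegrable (by norm_num)
  have hvl : LocallyIntegrable v halfLine := hv.memLp.locallyIntegrable (by norm_num)
  have hi : ∀ b, IntervalIntegrable ((Ioi 0).indicator fun x => L (weakDeriv v x)) volume 0 b := by
    intro b
    rw [intervalIntegrable_iff, IntegrableOn, integrable_indicator_iff measurableSet_Ioi,
      IntegrableOn, Measure.restrict_restrict measurableSet_Ioi, inter_comm,
      ← Measure.restrict_restrict measurableSet_uIoc]
    exact L.integrable_comp
      ((hdl.integrableOn_isCompact isCompact_uIcc).mono_set uIoc_subset_uIcc)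
  refine ⟨hi, fun x hx => eq_add_integral_of_isWeakDeriv (f := fun x => L (v x))
    (L.continuous.comp_continuousOn hv.continuousOn) hi (fun φ hφ hφc hφs => ?_) hx⟩
  have h := hd φ hφ hφc hφs
  have hdφ : Continuous (deriv φ) := hφ.continuous_deriv (by simp)
  have h1 : ∫ x in Ioi 0, deriv φ x * L (v x) = L (∫ x, deriv φ x • v x ∂halfLine) := by
    rw [← L.integral_comp_comm (hvl.integrable_smul_left_of_hasCompactSupport hdφ hφc.deriv)]
    simp
  have h2 : ∫ x in Ioi 0, φ x * (Ioi 0).indicator (fun x => L (weakDeriv v x)) x =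
      L (∫ x, φ x • weakDeriv v x ∂halfLine) := by
    rw [← L.integral_comp_comm
      (hdl.integrable_smul_left_of_hasCompactSupport hφ.continuous hφc)]
    refine setIntegral_congr_fun measurableSet_Ioi fun x hx => ?_
    simp [indicator_of_mem hx]
  rw [h1, h2, h, map_neg]

theorem MemH1.isDensity {𝕜 : Type*} [RCLike 𝕜] {v : ℝ → 𝕜} (hv : MemH1 v) :
    IsDensity (fun x => ‖v (max x 0)‖ ^ 2)
      (fun x => 2 * (RCLike.re (v x) * RCLike.re (weakDeriv v x) +
        RCLike.im (v x) * RCLike.im (weakDeriv v x)))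
      (fun x => ‖weakDeriv v x‖ ^ 2) := by
  obtain ⟨hri, hre⟩ := hv.clm_comp_eq RCLike.reCLM
  obtain ⟨hii, him⟩ := hv.clm_comp_eq RCLike.imCLM
  simp only [RCLike.reCLM_apply, RCLike.imCLM_apply] at hri hre hii him
  set P : ℝ → ℝ := fun x => RCLike.re (v 0) +
    ∫ t in 0..x, (Ioi 0).indicator (fun x => RCLike.re (weakDeriv v x)) t with hP
  set Q : ℝ → ℝ := fun x => RCLike.im (v 0) +
    ∫ t in 0..x, (Ioi 0).indicator (fun x => RCLike.im (weakDeriv v x)) t with hQ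
  have hN : ∀ x, 0 ≤ x → ‖v (max x 0)‖ ^ 2 = P x * P x + Q x * Q x := fun x hx => by
    rw [max_eq_left hx, RCLike.norm_sq_eq_def, hre x hx, him x hx]
  have hsq : ∀ (z w : 𝕜) (c : ℝ), ‖z‖ ^ 2 + c * (2 * (RCLike.re w * RCLike.re z +
      RCLike.im w * RCLike.im z)) + c ^ 2 * ‖w‖ ^ 2 =
      (RCLike.re z + c * RCLike.re w) ^ 2 + (RCLike.im z + c * RCLike.im w) ^ 2 := by
    intro z w c
    rw [RCLike.norm_sq_eq_def, RCLike.norm_sq_eq_def]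
    ring
  have hae : ∀ g : ℝ → ℝ, (∀ b, IntervalIntegrable ((Ioi 0).indicator g) volume 0 b) →
      ∀ᵐ x, 0 < x →
        HasDerivAt (fun x => ∫ t in 0..x, (Ioi 0).indicator g t) (g x) x := by
    intro g hg
    have : ∀ᵐ x, ∀ k : ℕ, x ∈ uIcc (0 : ℝ) k → ∀ c ∈ uIcc (0 : ℝ) k,
        HasDerivAt (fun x => ∫ t in c..x, (Ioi 0).indicator g t) ((Ioi 0).indicator g x) x :=
      ae_all_iff.2 fun k => (hg k).ae_hasDerivAt_integral
    filter_upwards [this] with x hx hx0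
    obtain ⟨k, hk⟩ := exists_nat_ge x
    have := hx k (by rw [uIcc_of_le (hx0.le.trans hk)]; exact ⟨hx0.le, hk⟩) 0 (by simp)
    rwa [indicator_of_mem (show x ∈ Ioi 0 from hx0)] at this
  refine ⟨?_, fun x => by positivity, ?_, fun b hb => ?_, ?_, ?_, fun x => by positivity, ?_⟩
  · exact ((hv.continuousOn.comp_continuous (by fun_prop) fun x => le_max_right x 0).norm).pow 2
  · refine (hv.memLp.integrable_norm_pow (by norm_num)).congr ?_
    filter_upwards [ae_restrict_mem measurableSet_Ioi] with x hx
    rw [max_eq_left (le_of_lt hx)]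
  · have hPac : AbsolutelyContinuousOnInterval P 0 b :=
      contDiffOn_const.absolutelyContinuousOnInterval.add
        ((hri b).absolutelyContinuousOnInterval_intervalIntegral (by simp))
    have hQac : AbsolutelyContinuousOnInterval Q 0 b :=
      contDiffOn_const.absolutelyContinuousOnInterval.add
        ((hii b).absolutelyContinuousOnInterval_intervalIntegral (by simp))
    have := (hPac.mul hPac).add (hQac.mul hQac)
    rw [absolutelyContinuousOnInterval_iff] at this ⊢
    intro ε hε
    obtain ⟨δ, hδ, h⟩ := this ε hε
    refine ⟨δ, hδ, fun E hE hE' => ?_⟩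
    refine (Finset.sum_congr rfl fun i hi => ?_).trans_lt (h E hE hE')
    have hmem := hE.1 i hi
    rw [uIcc_of_le hb] at hmem
    simp only [hN _ hmem.1.1, hN _ hmem.2.1]
    rfl
  · filter_upwards [hae _ hri, hae _ hii] with x h1 h2 hx
    have hP' : HasDerivAt P (RCLike.re (weakDeriv v x)) x := (h1 hx).const_add _
    have hQ' : HasDerivAt Q (RCLike.im (weakDeriv v x)) x := (h2 hx).const_add _
    have := (hP'.mul hP').add (hQ'.mul hQ')
    refine (this.congr_of_eventuallyEq ?_).congr_deriv ?_
    · filter_upwards [lt_mem_nhds hx] with y hy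
      rw [hN y hy.le]
      rfl
    · rw [hre x hx.le, him x hx.le]
      ring
  · exact hv.isL2WeakDeriv.1.integrable_norm_pow (by norm_num)
  · intro x hx c
    simp only [max_eq_left hx.le]
    rw [hsq]
    positivity

/-! ### The density of the soliton as a function of its tail mass -/

/-- `h` expresses the density `u²` of the soliton of mass `μ` in terms of the mass `τ` lying to the
right of the point considered, and `e` is its derivative. Differentiating `h`, `e` once more
recovers the stationary equation: `e² / 4 + κ hʳ` is conserved. The parameters are `a = -α`,
`r = (p - 2) / 2`, `κ = 2 / p`, and `Z = u(0)²`. -/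
structure IsTailProfile (κ r a μ Z : ℝ) (h e : ℝ → ℝ) : Prop where
  pos : 0 < Z
  map_zero : h 0 = 0
  map_mass : h μ = Z
  strictMono : StrictMono h
  hasDerivAt : ∀ τ, HasDerivAt h (e τ) τ
  exists_inverse : ∃ M : ℝ → ℝ, ∀ ζ, h (M ζ) = ζ ∧ HasDerivAt M (e (M ζ))⁻¹ ζ
  lipschitz : ∃ K, LipschitzWith K h
  deriv_eq : ∀ τ ∈ Icc 0 μ, e τ = 2 * √(a ^ 2 + κ * (Z ^ r - h τ ^ r))
  hasDerivAt_deriv : ∀ τ ∈ Ioc 0 μ, HasDerivAt e (-(2 * r * κ) * h τ ^ (r - 1)) τ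

/-- The square of half the slope of the tail profile with endpoint `Z`, as a function of its
value `ζ`. Truncating from below by a positive constant makes it defined on the whole line, without
changing it near `(0, Z]`. -/
noncomputable def profileSlopeSq (κ r a Z ζ : ℝ) : ℝ :=
  max (a ^ 2 / 4) (a ^ 2 + κ * (|Z| ^ r - |ζ| ^ r))

/-- The mass below the level `ζ`, i.e. the inverse of the tail profile with endpoint `Z`. -/
noncomputable def profileMass (κ r a Z ζ : ℝ) : ℝ :=
  ∫ t in 0..ζ, 1 / (2 * √(profileSlopeSq κ r a Z t))

section Profile

variable {κ r a : ℝ}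

theorem profileSlopeSq_pos (ha : 0 < a) (Z ζ : ℝ) : 0 < profileSlopeSq κ r a Z ζ :=
  lt_max_of_lt_left (by positivity)

theorem profileSlopeSq_le (hκ : 0 < κ) (Z ζ : ℝ) :
    profileSlopeSq κ r a Z ζ ≤ a ^ 2 + κ * |Z| ^ r := by
  have h1 : 0 ≤ |Z| ^ r := by positivity
  have h2 : 0 ≤ |ζ| ^ r := by positivity
  refine max_le ?_ ?_
  · nlinarith [sq_nonneg a, mul_nonneg hκ.le h1]
  · nlinarith [mul_nonneg hκ.le h2]

theorem continuous_profileSlopeSq (hr : 0 < r) :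
    Continuous (Function.uncurry (profileSlopeSq κ r a)) := by
  unfold profileSlopeSq Function.uncurry
  have h : Continuous fun x : ℝ => |x| ^ r := by
    exact continuous_abs.rpow_const fun _ => Or.inr hr.le
  exact continuous_const.max (continuous_const.add (continuous_const.mul
    ((h.comp continuous_fst).sub (h.comp continuous_snd))))

theorem continuous_profileMass_integrand (hr : 0 < r) (ha : 0 < a) :
    Continuous (Function.uncurry fun Z t : ℝ => 1 / (2 * √(profileSlopeSq κ r a Z t))) := by
  refine continuous_const.div (continuous_const.mul (continuous_profileSlopeSq hr).sqrt) ?_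
  rintro ⟨Z, ζ⟩
  have := Real.sqrt_pos.2 (profileSlopeSq_pos (κ := κ) (r := r) ha Z ζ)
  exact (mul_pos two_pos this).ne'

theorem hasDerivAt_profileMass (hr : 0 < r) (ha : 0 < a) (Z ζ : ℝ) :
    HasDerivAt (profileMass κ r a Z) (1 / (2 * √(profileSlopeSq κ r a Z ζ))) ζ := by
  have hc : Continuous fun t : ℝ => 1 / (2 * √(profileSlopeSq κ r a Z t)) :=
    (continuous_profileMass_integrand hr ha).comp (Continuous.prodMk_right Z)
  exact intervalIntegral.integral_hasDerivAt_right (hc.intervalIntegrable _ _)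
    (hc.stronglyMeasurableAtFilter _ _) hc.continuousAt

theorem monotone_profileMass_sub (hκ : 0 < κ) (hr : 0 < r) (ha : 0 < a) (Z : ℝ) :
    Monotone fun ζ => profileMass κ r a Z ζ - 1 / (2 * √(a ^ 2 + κ * |Z| ^ r)) * ζ := by
  have hd : ∀ ζ, HasDerivAt
      (fun ζ => profileMass κ r a Z ζ - 1 / (2 * √(a ^ 2 + κ * |Z| ^ r)) * ζ)
      (1 / (2 * √(profileSlopeSq κ r a Z ζ)) - 1 / (2 * √(a ^ 2 + κ * |Z| ^ r)) * 1) ζ :=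
    fun ζ => (hasDerivAt_profileMass hr ha Z ζ).sub ((hasDerivAt_id ζ).const_mul _)
  refine monotone_of_deriv_nonneg (fun ζ => (hd ζ).differentiableAt) fun ζ => ?_
  rw [(hd ζ).deriv, mul_one, sub_nonneg]
  have := Real.sqrt_pos.2 (profileSlopeSq_pos (κ := κ) (r := r) ha Z ζ)
  exact one_div_le_one_div_of_le (by positivity)
    (mul_le_mul_of_nonneg_left (Real.sqrt_le_sqrt (profileSlopeSq_le hκ Z ζ)) two_pos.le)

theorem profileMass_zero (Z : ℝ) : profileMass κ r a Z 0 = 0 := by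
  simp [profileMass]

/-- Every mass is attained by some profile. Subcriticality enters through `r < 2`. -/
theorem exists_profileMass_eq (hκ : 0 < κ) (hr : 0 < r) (hr2 : r < 2) (ha : 0 < a) {μ : ℝ}
    (hμ : 0 < μ) : ∃ Z, 0 < Z ∧ profileMass κ r a Z Z = μ := by
  have hc : Continuous fun Z => profileMass κ r a Z Z :=
    (intervalIntegral.continuous_parametric_primitive_of_continuous (a₀ := 0)
      (continuous_profileMass_integrand (κ := κ) hr ha)).comp (continuous_id.prodMk continuous_id)
  obtain ⟨Y, hY1, hY⟩ : ∃ Y : ℝ, 1 ≤ Y ∧ μ * (2 * √(a ^ 2 + κ)) ≤ Y ^ (1 - r / 2) := by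
    have ht := tendsto_rpow_atTop (y := 1 - r / 2) (by linarith)
    obtain ⟨Y, h1, h2⟩ := ((ht.eventually_ge_atTop (μ * (2 * √(a ^ 2 + κ)))).and
      (Filter.eventually_ge_atTop 1)).exists
    exact ⟨Y, h2, h1⟩
  have hY0 : 0 < Y := by linarith
  have hge : μ ≤ profileMass κ r a Y Y := by
    have h1 := monotone_profileMass_sub (r := r) hκ hr ha Y hY0.le
    simp only [profileMass_zero, mul_zero, sub_zero, abs_of_pos hY0] at h1
    have h2 : a ^ 2 + κ * Y ^ r ≤ (a ^ 2 + κ) * Y ^ r := by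
      have := Real.one_le_rpow hY1 hr.le
      nlinarith [sq_nonneg a]
    have h3 : √(a ^ 2 + κ * Y ^ r) ≤ √(a ^ 2 + κ) * Y ^ (r / 2) := by
      refine (Real.sqrt_le_sqrt h2).trans_eq ?_
      rw [Real.sqrt_mul (by positivity), Real.sqrt_eq_rpow (Y ^ r), ← Real.rpow_mul hY0.le]
      congr 2
      ring
    have h4 : μ * (2 * √(a ^ 2 + κ * Y ^ r)) ≤ Y := by
      calc μ * (2 * √(a ^ 2 + κ * Y ^ r)) ≤ μ * (2 * (√(a ^ 2 + κ) * Y ^ (r / 2))) := by gcongr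
        _ = μ * (2 * √(a ^ 2 + κ)) * Y ^ (r / 2) := by ring
        _ ≤ Y ^ (1 - r / 2) * Y ^ (r / 2) := by gcongr
        _ = Y := by rw [← Real.rpow_add hY0]; simp
    have h5 : 0 < 2 * √(a ^ 2 + κ * Y ^ r) := by positivity
    have h6 : μ ≤ 1 / (2 * √(a ^ 2 + κ * Y ^ r)) * Y := by
      rw [one_div_mul_eq_div, le_div_iff₀ h5]
      exact h4
    linarith
  obtain ⟨Z, hZ, hZμ⟩ := intermediate_value_Icc hY0.le hc.continuousOn
    (show μ ∈ Icc _ _ from ⟨by simpa [profileMass_zero] using hμ.le, hge⟩)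
  refine ⟨Z, lt_of_le_of_ne hZ.1 ?_, hZμ⟩
  rintro rfl
  simp only [profileMass_zero] at hZμ
  exact hμ.ne hZμ

theorem exists_isTailProfile (hκ : 0 < κ) (hr : 0 < r) (hr2 : r < 2) (ha : 0 < a) {μ : ℝ}
    (hμ : 0 < μ) : ∃ Z h e, IsTailProfile κ r a μ Z h e := by
  obtain ⟨Z, hZ, hZμ⟩ := exists_profileMass_eq hκ hr hr2 ha hμ
  set c := 1 / (2 * √(a ^ 2 + κ * |Z| ^ r)) with hc
  have hc0 : 0 < c := by positivity
  have hmono := monotone_profileMass_sub (r := r) hκ hr ha Z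
  have hstrict : StrictMono (profileMass κ r a Z) := by
    intro x y hxy
    have := hmono hxy.le
    simp only at this
    nlinarith
  have hcont : Continuous (profileMass κ r a Z) :=
    continuous_iff_continuousAt.2 fun ζ => (hasDerivAt_profileMass hr ha Z ζ).continuousAt
  have hsurj : Function.Surjective (profileMass κ r a Z) := by
    refine hcont.surjective ?_ ?_
    · refine Filter.tendsto_atTop_mono' _ ?_ (Filter.tendsto_id.const_mul_atTop hc0)
      filter_upwards [Filter.eventually_ge_atTop 0] with x hx
      have := hmono hx
      simp only [profileMass_zero, mul_zero, sub_zero] at this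
      simp only [id]
      linarith
    · refine Filter.tendsto_atBot_mono' _ ?_ (Filter.tendsto_id.const_mul_atBot hc0)
      filter_upwards [Filter.eventually_le_atBot 0] with x hx
      have := hmono hx
      simp only [profileMass_zero, mul_zero, sub_zero] at this
      simp only [id]
      linarith
  set h := (hstrict.orderIsoOfSurjective _ hsurj).symm with hh
  have hMh : ∀ τ, profileMass κ r a Z (h τ) = τ :=
    fun τ => hstrict.orderIsoOfSurjective_self_symm_apply _ hsurj τ
  have hhM : ∀ ζ, h (profileMass κ r a Z ζ) = ζ :=
    fun ζ => hstrict.orderIsoOfSurjective_symm_apply_self _ hsurj ζ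
  have hh0 : h 0 = 0 := by simpa [profileMass_zero] using hhM 0
  have hhμ : h μ = Z := by conv_lhs => rw [← hZμ, hhM]
  have hhmono : StrictMono h := h.strictMono
  have hd : ∀ τ, HasDerivAt h (2 * √(profileSlopeSq κ r a Z (h τ))) τ := by
    intro τ
    have hs := Real.sqrt_pos.2 (profileSlopeSq_pos (κ := κ) (r := r) ha Z (h τ))
    have := (hasDerivAt_profileMass (κ := κ) hr ha Z (h τ)).of_local_left_inverse
      h.continuous.continuousAt (by positivity) (Filter.Eventually.of_forall hMh)
    simpa using this
  have hcontS : Continuous fun ζ => a ^ 2 + κ * (|Z| ^ r - |ζ| ^ r) := by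
    have h : Continuous fun x : ℝ => |x| ^ r := by
      exact continuous_abs.rpow_const fun _ => Or.inr hr.le
    exact continuous_const.add (continuous_const.mul (continuous_const.sub h))
  refine ⟨Z, h, fun τ => 2 * √(profileSlopeSq κ r a Z (h τ)), hZ, hh0, hhμ, hhmono, hd,
    ⟨profileMass κ r a Z, fun ζ => ⟨hhM ζ, ?_⟩⟩, ?_, ?_, ?_⟩
  · simpa only [hhM, one_div] using hasDerivAt_profileMass (κ := κ) hr ha Z ζ
  · refine ⟨(2 * √(a ^ 2 + κ * |Z| ^ r)).toNNReal, lipschitzWith_of_nnnorm_deriv_le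
      (fun τ => (hd τ).differentiableAt) fun τ => ?_⟩
    rw [(hd τ).deriv, ← NNReal.coe_le_coe, coe_nnnorm, Real.coe_toNNReal _ (by positivity),
      Real.norm_of_nonneg (by positivity)]
    exact mul_le_mul_of_nonneg_left (Real.sqrt_le_sqrt (profileSlopeSq_le hκ Z _)) two_pos.le
  · intro τ hτ
    have h1 : 0 ≤ h τ := hh0 ▸ hhmono.monotone hτ.1
    have h2 : h τ ≤ Z := hhμ ▸ hhmono.monotone hτ.2
    have h3 := Real.rpow_le_rpow h1 h2 hr.le
    simp only [profileSlopeSq, abs_of_pos hZ, abs_of_nonneg h1]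
    rw [max_eq_right]
    nlinarith [sq_nonneg a, mul_nonneg hκ.le (sub_nonneg.2 h3)]
  · intro τ hτ
    have h1 : 0 < h τ := hh0 ▸ hhmono hτ.1
    have h2 : h τ ≤ Z := hhμ ▸ hhmono.monotone hτ.2
    have h3 := Real.rpow_le_rpow h1.le h2 hr.le
    -- the truncation is inactive in a neighbourhood of `h τ`
    have hgt : a ^ 2 / 4 < a ^ 2 + κ * (|Z| ^ r - |h τ| ^ r) := by
      rw [abs_of_pos hZ, abs_of_pos h1]
      nlinarith [pow_pos ha 2, mul_nonneg hκ.le (sub_nonneg.2 h3)]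
    have hev : ∀ᶠ t in nhds τ,
        profileSlopeSq κ r a Z (h t) = a ^ 2 + κ * (Z ^ r - h t ^ r) := by
      filter_upwards [(hcontS.comp h.continuous).continuousAt.eventually_const_lt hgt,
        h.continuous.continuousAt.eventually_const_lt h1] with t ht1 ht2
      have ht1' : a ^ 2 / 4 < a ^ 2 + κ * (|Z| ^ r - |h t| ^ r) := ht1
      have ht2' : 0 < h t := ht2
      rw [profileSlopeSq, max_eq_right ht1'.le, abs_of_pos hZ, abs_of_pos ht2']
    have heq := hev.self_of_nhds
    have hpos := profileSlopeSq_pos (κ := κ) (r := r) ha Z (h τ)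
    have hder : HasDerivAt (fun t => 2 * √(a ^ 2 + κ * (Z ^ r - h t ^ r)))
        (2 * ((κ * (-(2 * √(profileSlopeSq κ r a Z (h τ)) * r * h τ ^ (r - 1)))) /
          (2 * √(a ^ 2 + κ * (Z ^ r - h τ ^ r))))) τ := by
      have := (((hd τ).rpow_const (p := r) (Or.inl h1.ne')).const_sub (Z ^ r)).const_mul κ
      exact ((this.const_add (a ^ 2)).sqrt (by rw [← heq]; exact hpos.ne')).const_mul 2
    refine (hder.congr_of_eventuallyEq ?_).congr_deriv ?_
    · filter_upwards [hev] with t ht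
      rw [ht]
    · rw [← heq]
      have := (Real.sqrt_pos.2 hpos).ne'
      field_simp

end Profile

/-! ### The soliton as a function of position -/

/-- The explicit soliton density `z = Z (cosh βx + ρ sinh βx)^(-2/r)` solves the first-order form
of the stationary equation. -/
theorem exists_soliton_density {κ r a Z : ℝ} (hκ : 0 < κ) (hr : 0 < r) (ha : 0 < a) (hZ : 0 < Z) :
    ∃ z : ℝ → ℝ, z 0 = Z ∧ (∀ x, 0 ≤ x → 0 < z x ∧ z x ≤ Z ∧
      HasDerivAt z (-(z x * (2 * √(a ^ 2 + κ * (Z ^ r - z x ^ r))))) x) ∧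
      Filter.Tendsto z Filter.atTop (nhds 0) := by
  set s := √(a ^ 2 + κ * Z ^ r) with hs
  have hs0 : 0 < s := Real.sqrt_pos.2 (by positivity)
  have hs2 : s ^ 2 = a ^ 2 + κ * Z ^ r := Real.sq_sqrt (by positivity)
  set β := r * s with hβ
  have hβ0 : 0 < β := mul_pos hr hs0
  set W : ℝ → ℝ := fun x => Real.cosh (β * x) + a / s * Real.sinh (β * x) with hW
  set V : ℝ → ℝ := fun x => Real.sinh (β * x) + a / s * Real.cosh (β * x) with hV
  have hWd : ∀ x, HasDerivAt W (β * V x) x := by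
    intro x
    have hlin : HasDerivAt (fun x => β * x) β x := by simpa using (hasDerivAt_id x).const_mul β
    exact (hlin.cosh.add (hlin.sinh.const_mul (a / s))).congr_deriv (by simp only [hV]; ring)
  have hW1 : ∀ x, 0 ≤ x → Real.cosh (β * x) ≤ W x := by
    intro x hx
    have : 0 ≤ Real.sinh (β * x) := Real.sinh_nonneg_iff.2 (by positivity)
    simp only [hW]
    have : 0 ≤ a / s * Real.sinh (β * x) := by positivity
    linarith
  have hone : ∀ x, 0 ≤ x → 1 ≤ W x := fun x hx => (Real.one_le_cosh _).trans (hW1 x hx)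
  have hV0 : ∀ x, 0 ≤ x → 0 ≤ V x := by
    intro x hx
    have h1 : 0 ≤ Real.sinh (β * x) := Real.sinh_nonneg_iff.2 (by positivity)
    have h2 := Real.cosh_pos (β * x)
    simp only [hV]
    positivity
  have hWV : ∀ x, (s * V x) ^ 2 = (s * W x) ^ 2 - κ * Z ^ r := by
    intro x
    have h1 := Real.cosh_sq (β * x)
    simp only [hW, hV]
    have : κ * Z ^ r = s ^ 2 - a ^ 2 := by rw [hs2]; ring
    rw [this]
    field_simp
    linear_combination (a ^ 2 - s ^ 2) * h1
  refine ⟨fun x => Z * W x ^ (-(2 / r)), ?_, fun x hx => ?_, ?_⟩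
  · simp [hW]
  · have hWx : 0 < W x := one_pos.trans_le (hone x hx)
    have hpow : (Z * W x ^ (-(2 / r))) ^ r = Z ^ r / W x ^ 2 := by
      rw [Real.mul_rpow hZ.le (by positivity), ← Real.rpow_mul hWx.le,
        show -(2 / r) * r = -2 by field_simp, Real.rpow_neg hWx.le, Real.rpow_two]
      rfl
    have hsqrt : √(a ^ 2 + κ * (Z ^ r - (Z * W x ^ (-(2 / r))) ^ r)) = s * V x / W x := by
      rw [← Real.sqrt_sq (show 0 ≤ s * V x / W x from
        div_nonneg (mul_nonneg hs0.le (hV0 x hx)) hWx.le), div_pow, hWV, hpow, mul_pow, hs2]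
      congr 1
      field_simp
      ring
    refine ⟨by positivity, ?_, ?_⟩
    · refine mul_le_of_le_one_right hZ.le (Real.rpow_le_one_of_one_le_of_nonpos (hone x hx) ?_)
      rw [Left.neg_nonpos_iff]
      positivity
    · refine (((hWd x).rpow_const (p := -(2 / r)) (Or.inl hWx.ne')).const_mul Z).congr_deriv ?_
      rw [hsqrt, Real.rpow_sub_one hWx.ne', hβ]
      field_simp
  · have hWt : Filter.Tendsto W Filter.atTop Filter.atTop := by
      refine Filter.tendsto_atTop_mono' _ ?_ (((Real.tendsto_exp_atTop.comp
        (Filter.tendsto_id.const_mul_atTop hβ0))).atTop_div_const two_pos)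
      filter_upwards [Filter.eventually_ge_atTop 0] with x hx
      refine le_trans ?_ (hW1 x hx)
      rw [Real.cosh_eq]
      have := Real.exp_pos (-(β * x))
      simp only [Function.comp, id]
      linarith
    simpa using ((tendsto_rpow_neg_atTop (show 0 < 2 / r by positivity)).comp hWt).const_mul Z

/-- The mass of the soliton to the right of a point: it solves `m' = -h(m)`. -/
theorem IsTailProfile.exists_tailMass {κ r a μ Z : ℝ} {h e : ℝ → ℝ}
    (H : IsTailProfile κ r a μ Z h e) (hκ : 0 < κ) (hr : 0 < r) (ha : 0 < a) :
    ∃ m : ℝ → ℝ, m 0 = μ ∧ (∀ x, 0 ≤ x → m x ∈ Ioc 0 μ ∧ HasDerivAt m (-h (m x)) x) ∧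
      Filter.Tendsto m Filter.atTop (nhds 0) := by
  obtain ⟨z, hz0, hz, hzt⟩ := exists_soliton_density hκ hr ha H.pos
  obtain ⟨M, hM⟩ := H.exists_inverse
  have hMh : ∀ τ, M (h τ) = τ := fun τ => H.strictMono.injective (hM (h τ)).1
  have hM0 : M 0 = 0 := by rw [← H.map_zero, hMh, H.map_zero]
  have hMμ : M Z = μ := by rw [← H.map_mass, hMh]
  have hmem : ∀ x, 0 ≤ x → M (z x) ∈ Ioc 0 μ := by
    intro x hx
    obtain ⟨h1, h2, -⟩ := hz x hx
    constructor
    · rw [← H.strictMono.lt_iff_lt, (hM _).1, H.map_zero]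
      exact h1
    · rw [← H.strictMono.le_iff_le, (hM _).1, H.map_mass]
      exact h2
  refine ⟨fun x => M (z x), by simp only [hz0, hMμ], fun x hx => ⟨hmem x hx, ?_⟩, ?_⟩
  · obtain ⟨h1, h2, h3⟩ := hz x hx
    have he := H.deriv_eq _ (Ioc_subset_Icc_self (hmem x hx))
    rw [(hM _).1] at he
    refine ((hM (z x)).2.comp x h3).congr_deriv ?_
    have hpos : 0 < e (M (z x)) := by
      rw [he]
      have := Real.rpow_le_rpow h1.le h2 hr.le
      have := mul_nonneg hκ.le (sub_nonneg.2 this)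
      positivity
    rw [← he, (hM _).1]
    field_simp
  · have := (hM 0).2.continuousAt.tendsto.comp hzt
    rwa [hM0] at this

/-! ### The defect in Young's inequality -/

/-- The defect `r/2 N² hʳ⁻² - Nʳ + (1 - r/2) hʳ` in Young's inequality for the exponents `2 / r`
and `2 / (2 - r)`. -/
noncomputable def youngDefect (r N h : ℝ) : ℝ :=
  r / 2 * (N ^ 2 * h ^ (r - 2)) - N ^ r + (1 - r / 2) * h ^ r

theorem youngDefect_eq {r N h : ℝ} (hN : 0 ≤ N) (hh : 0 < h) :
    youngDefect r N h =
      h ^ r * (1 + r / 2 * ((N / h) ^ 2 - 1) - (1 + ((N / h) ^ 2 - 1)) ^ (r / 2)) := by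
  have h1 : (1 + ((N / h) ^ 2 - 1)) ^ (r / 2) = N ^ r / h ^ r := by
    rw [add_sub_cancel, ← Real.rpow_two, ← Real.rpow_mul (by positivity),
      show 2 * (r / 2) = r by ring, Real.div_rpow hN hh.le]
  have h2 : h ^ (r - 2) = h ^ r / h ^ 2 := by
    rw [Real.rpow_sub hh, Real.rpow_two]
  have := (Real.rpow_pos_of_pos hh r).ne'
  rw [h1, youngDefect, h2]
  field_simp
  ring

theorem youngDefect_nonneg {r N h : ℝ} (hr : 0 < r) (hr2 : r < 2) (hN : 0 ≤ N) (hh : 0 < h) :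
    0 ≤ youngDefect r N h := by
  rw [youngDefect_eq hN hh]
  refine mul_nonneg (by positivity) (sub_nonneg.2 ?_)
  have := sq_nonneg (N / h)
  exact rpow_one_add_le_one_add_mul_self (by linarith) (by linarith) (by linarith)

theorem eq_of_youngDefect_eq_zero {r N h : ℝ} (hr : 0 < r) (hr2 : r < 2) (hN : 0 ≤ N) (hh : 0 < h)
    (h0 : youngDefect r N h = 0) : N = h := by
  by_contra hne
  have hne' : (N / h) ^ 2 - 1 ≠ 0 := by
    intro h1
    have h2 : N / h = 1 := by
      have : 0 ≤ N / h := by positivity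
      nlinarith
    exact hne ((div_eq_one_iff_eq hh.ne').1 h2)
  rw [youngDefect_eq hN hh] at h0
  have h2 := sq_nonneg (N / h)
  have h3 := rpow_one_add_lt_one_add_mul_self (s := (N / h) ^ 2 - 1) (p := r / 2)
    (by linarith) hne' (by linarith) (by linarith)
  have := mul_pos (Real.rpow_pos_of_pos hh r) (sub_pos.2 h3)
  exact this.ne' h0

/-! ### Tail estimates -/

theorem absolutelyContinuousOnInterval_of_hasDerivAt {f f' : ℝ → ℝ} {a b : ℝ}
    (hf : ∀ x ∈ uIcc a b, HasDerivAt f (f' x) x) (hf' : ContinuousOn f' (uIcc a b)) :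
    AbsolutelyContinuousOnInterval f a b := by
  obtain ⟨C, hC⟩ := isCompact_uIcc.exists_bound_of_continuousOn hf'
  refine LipschitzOnWith.absolutelyContinuousOnInterval (K := C.toNNReal)
    ((convex_uIcc a b).lipschitzOnWith_of_nnnorm_hasDerivWithin_le
      (fun x hx => (hf x hx).hasDerivWithinAt) fun x hx => ?_)
  rw [← NNReal.coe_le_coe, coe_nnnorm]
  exact (hC x hx).trans (Real.le_coe_toNNReal C)

section Tail

variable {N n D : ℝ → ℝ}

theorem IsDensity.integrableOn_Ioi (hN : IsDensity N n D) {x : ℝ} (hx : 0 ≤ x) :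
    IntegrableOn N (Ioi x) :=
  hN.integrable.mono_set (Ioi_subset_Ioi hx)

theorem IsDensity.integrableOn_deriv_Ioi (hN : IsDensity N n D) {x : ℝ} (hx : 0 ≤ x) :
    IntegrableOn D (Ioi x) :=
  hN.integrable_deriv.mono_set (Ioi_subset_Ioi hx)

/-- The weighted form of `N(x) ≤ 2 ‖v‖ ‖v'‖` on `(x, ∞)`. -/
theorem IsDensity.le_weighted (hN : IsDensity N n D) {x t : ℝ} (hx : 0 ≤ x) (ht : 0 < t) :
    N x ≤ t * (∫ y in Ioi x, N y) + (∫ y in Ioi x, D y) / t := by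
  set A := ∫ y in Ioi x, N y with hA
  set B := ∫ y in Ioi x, D y with hB
  have hiN := hN.integrableOn_Ioi hx
  have hiD := hN.integrableOn_deriv_Ioi hx
  have hsum : IntegrableOn (fun y => t * N y + D y / t) (Ioi x) :=
    (hiN.const_mul t).add (hiD.div_const t)
  have hstep : ∀ b, x ≤ b → N x ≤ N b + (t * A + B / t) := by
    intro b hb
    have hac : AbsolutelyContinuousOnInterval N x b :=
      (hN.absolutelyContinuous b (hx.trans hb)).mono (by
        rw [uIcc_of_le hb, uIcc_of_le (hx.trans hb)]
        exact Icc_subset_Icc_left hx)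
    have h1 := hac.integral_deriv_eq_sub
    have h2 : ∫ y in x..b, -(t * N y + D y / t) ≤ ∫ y in x..b, deriv N y := by
      refine intervalIntegral.integral_mono_ae_restrict hb ?_ hac.intervalIntegrable_deriv ?_
      · rw [intervalIntegrable_iff_integrableOn_Ioc_of_le hb]
        exact (hsum.mono_set Ioc_subset_Ioi_self).neg
      · have : ∀ᵐ y, y ∈ Icc x b → y ≠ x := by
          filter_upwards [Measure.ae_ne volume x] with y hy _ using hy
        filter_upwards [ae_restrict_of_ae hN.hasDerivAt, ae_restrict_mem measurableSet_Icc,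
          ae_restrict_of_ae this] with y hy hyI hyx
        have hy0 : 0 < y := hx.trans_lt (lt_of_le_of_ne hyI.1 (hyx hyI).symm)
        rw [(hy hy0).deriv]
        have hq := hN.quadratic y hy0 t
        have h5 : D y / t * t = D y := div_mul_cancel₀ _ ht.ne'
        have : 0 ≤ t * (D y / t + n y + t * N y) := by linarith
        have := nonneg_of_mul_nonneg_right this ht
        linarith
    have h3 : ∫ y in x..b, (t * N y + D y / t) ≤ t * A + B / t := by
      rw [intervalIntegral.integral_of_le hb]
      refine (setIntegral_mono_set hsum ?_ Ioc_subset_Ioi_self.eventuallyLE).trans_eq ?_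
      · exact Filter.Eventually.of_forall fun y =>
          add_nonneg (mul_nonneg ht.le (hN.nonneg y)) (div_nonneg (hN.deriv_nonneg y) ht.le)
      · rw [integral_add (hiN.const_mul t) (hiD.div_const t), integral_const_mul,
          integral_div]
    rw [intervalIntegral.integral_neg] at h2
    linarith
  -- average over a long interval, on which `N` has bounded integral
  by_contra! hlt
  set δ := N x - (t * A + B / t) with hδ
  have hδ0 : 0 < δ := by linarith
  have hA0 : 0 ≤ A := setIntegral_nonneg measurableSet_Ioi fun y _ => hN.nonneg y
  set L := A / δ + 1 with hL
  have hL0 : 0 < L := by positivity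
  have hxL : x ≤ x + L := by linarith
  have h1 : ∫ _ in x..(x + L), δ ≤ ∫ y in x..(x + L), N y :=
    intervalIntegral.integral_mono_on hxL intervalIntegrable_const
      (hN.continuous.intervalIntegrable _ _) fun y hy => by
        have := hstep y hy.1
        linarith
  have h2 : ∫ y in x..(x + L), N y ≤ A := by
    rw [intervalIntegral.integral_of_le hxL]
    exact setIntegral_mono_set hiN (Filter.Eventually.of_forall hN.nonneg)
      Ioc_subset_Ioi_self.eventuallyLE
  rw [intervalIntegral.integral_const, smul_eq_mul, add_sub_cancel_left] at h1
  have h3 : L * δ = A + δ := by rw [hL]; field_simp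
  linarith

theorem IsDensity.sq_le (hN : IsDensity N n D) {x : ℝ} (hx : 0 ≤ x)
    (hA : 0 < ∫ y in Ioi x, N y) :
    N x ^ 2 ≤ 4 * (∫ y in Ioi x, N y) * ∫ y in Ioi x, D y := by
  set A := ∫ y in Ioi x, N y
  set B := ∫ y in Ioi x, D y with hB
  have hB0 : 0 ≤ B := setIntegral_nonneg measurableSet_Ioi fun y _ => hN.deriv_nonneg y
  rcases (hN.nonneg x).eq_or_lt with h0 | h0
  · rw [← h0, zero_pow two_ne_zero]
    exact mul_nonneg (mul_nonneg (by norm_num) hA.le) hB0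
  · have h1 := hN.le_weighted hx (t := N x / (2 * A)) (by positivity)
    have h2 : N x / (2 * A) * A = N x / 2 := by field_simp
    have h3 : B / (N x / (2 * A)) * N x = 2 * A * B := by field_simp
    rw [← hB, h2] at h1
    nlinarith

theorem IsDensity.bounded (hN : IsDensity N n D) {x : ℝ} (hx : 0 ≤ x) :
    N x ≤ (∫ y in Ioi 0, N y) + ∫ y in Ioi 0, D y := by
  have h1 := hN.le_weighted hx one_pos
  have h2 : ∫ y in Ioi x, N y ≤ ∫ y in Ioi 0, N y :=
    setIntegral_mono_set hN.integrable (Filter.Eventually.of_forall hN.nonneg)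
      (Ioi_subset_Ioi hx).eventuallyLE
  have h3 : ∫ y in Ioi x, D y ≤ ∫ y in Ioi 0, D y :=
    setIntegral_mono_set hN.integrable_deriv (Filter.Eventually.of_forall hN.deriv_nonneg)
      (Ioi_subset_Ioi hx).eventuallyLE
  linarith

/-- `tailMass μ N x` is the mass of the density `N` on `(x, ∞)` if `μ` is its mass on `(0, ∞)`. -/
noncomputable def tailMass (μ : ℝ) (N : ℝ → ℝ) (x : ℝ) : ℝ := μ - ∫ t in 0..x, N t

theorem hasDerivAt_tailMass (μ : ℝ) (hN : Continuous N) (x : ℝ) :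
    HasDerivAt (tailMass μ N) (-N x) x :=
  (intervalIntegral.integral_hasDerivAt_right (hN.intervalIntegrable _ _)
    (hN.stronglyMeasurableAtFilter _ _) hN.continuousAt).const_sub μ

theorem IsDensity.tailMass_eq (hN : IsDensity N n D) {μ x : ℝ} (hμ : ∫ y in Ioi 0, N y = μ)
    (hx : 0 ≤ x) : tailMass μ N x = ∫ y in Ioi x, N y := by
  have h := intervalIntegral.integral_Ioi_sub_Ioi hN.integrable hx
  rw [tailMass, ← hμ, ← h]
  ring

theorem IsDensity.tailMass_le (hN : IsDensity N n D) {μ x : ℝ} (hx : 0 ≤ x) :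
    tailMass μ N x ≤ μ := by
  have := intervalIntegral.integral_nonneg (μ := volume) hx fun t _ => hN.nonneg t
  rw [tailMass]
  linarith

theorem IsDensity.tailMass_antitone (hN : IsDensity N n D) (μ : ℝ) :
    Antitone (tailMass μ N) :=
  antitone_of_deriv_nonpos (fun x => (hasDerivAt_tailMass μ hN.continuous x).differentiableAt)
    fun x => by
      rw [(hasDerivAt_tailMass μ hN.continuous x).deriv]
      exact neg_nonpos.2 (hN.nonneg x)

end Tail

/-! ### The calibration and the lower bound for the energy -/

/-- The calibration: a function of the density `N` at a point and of the mass `τ` to the right of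
it. The first term is `⅛ N² (log h)'(τ)`. -/
noncomputable def calibration (κ r : ℝ) (h e : ℝ → ℝ) (N τ : ℝ) : ℝ :=
  1 / 8 * N ^ 2 * (e τ / h τ) - κ / 2 * (1 - r / 2) * ∫ t in 0..τ, h t ^ r

section Calibration

variable {κ r a μ Z : ℝ} {h e N n D : ℝ → ℝ}

theorem IsTailProfile.continuous (H : IsTailProfile κ r a μ Z h e) : Continuous h :=
  continuous_iff_continuousAt.2 fun τ => (H.hasDerivAt τ).continuousAt

theorem IsTailProfile.apply_pos (H : IsTailProfile κ r a μ Z h e) {τ : ℝ} (hτ : 0 < τ) :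
    0 < h τ := H.map_zero ▸ H.strictMono hτ

theorem IsTailProfile.apply_nonneg (H : IsTailProfile κ r a μ Z h e) {τ : ℝ} (hτ : 0 ≤ τ) :
    0 ≤ h τ := H.map_zero ▸ H.strictMono.monotone hτ

theorem IsTailProfile.apply_le (H : IsTailProfile κ r a μ Z h e) {τ : ℝ} (hτ : τ ≤ μ) :
    h τ ≤ Z := H.map_mass ▸ H.strictMono.monotone hτ

theorem IsTailProfile.deriv_mass (H : IsTailProfile κ r a μ Z h e) (ha : 0 < a) (hμ : 0 < μ) :
    e μ = 2 * a := by
  rw [H.deriv_eq μ ⟨hμ.le, le_rfl⟩, H.map_mass, sub_self, mul_zero, add_zero, Real.sqrt_sq ha.le]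

/-- The tail profile is concave, so that its slope is at most that of the chord from the origin. -/
theorem IsTailProfile.mul_deriv_le (H : IsTailProfile κ r a μ Z h e) (hκ : 0 < κ) (hr : 0 < r)
    {τ : ℝ} (hτ : τ ∈ Ioc 0 μ) : τ * e τ ≤ h τ := by
  have hanti : ∀ t ∈ Icc 0 τ, e τ ≤ e t := by
    intro t ht
    rw [H.deriv_eq t ⟨ht.1, ht.2.trans hτ.2⟩, H.deriv_eq τ ⟨hτ.1.le, hτ.2⟩]
    have := Real.rpow_le_rpow (H.apply_nonneg ht.1) (H.strictMono.monotone ht.2) hr.le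
    gcongr
  have hd : ∀ t, HasDerivAt (fun t => h t - e τ * t) (e t - e τ * 1) t :=
    fun t => (H.hasDerivAt t).sub ((hasDerivAt_id t).const_mul (e τ))
  have hmono : MonotoneOn (fun t => h t - e τ * t) (Icc 0 τ) := by
    refine monotoneOn_of_deriv_nonneg (convex_Icc 0 τ)
      (fun t _ => (hd t).continuousAt.continuousWithinAt)
      (fun t _ => (hd t).differentiableAt.differentiableWithinAt) fun t ht => ?_
    rw [interior_Icc] at ht
    rw [(hd t).deriv]
    linarith [hanti t (Ioo_subset_Icc_self ht)]
  have := hmono ⟨le_rfl, hτ.1.le⟩ ⟨hτ.1.le, le_rfl⟩ hτ.1.le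
  simp only [H.map_zero, mul_zero, sub_zero] at this
  linarith

theorem IsTailProfile.hasDerivAt_potential (H : IsTailProfile κ r a μ Z h e) (hr : 0 < r) (τ : ℝ) :
    HasDerivAt (fun τ => ∫ t in 0..τ, h t ^ r) (h τ ^ r) τ := by
  have hc : Continuous fun t => h t ^ r := H.continuous.rpow_const fun _ => Or.inr hr.le
  exact intervalIntegral.integral_hasDerivAt_right (hc.intervalIntegrable _ _)
    (hc.stronglyMeasurableAtFilter _ _) hc.continuousAt

theorem IsTailProfile.hasDerivAt_ratio_comp (H : IsTailProfile κ r a μ Z h e) {m : ℝ → ℝ}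
    {m' x : ℝ} (hm : HasDerivAt m m' x) (hx : m x ∈ Ioc 0 μ) :
    HasDerivAt (fun y => e (m y) / h (m y))
      (-(2 * r * κ * h (m x) ^ (r - 2) + (e (m x) / h (m x)) ^ 2) * m') x := by
  have hpos := H.apply_pos hx.1
  refine (((H.hasDerivAt_deriv _ hx).comp x hm).div ((H.hasDerivAt _).comp x hm)
    hpos.ne').congr_deriv ?_
  have h1 : h (m x) ^ (r - 1) = h (m x) ^ (r - 2) * h (m x) := by
    rw [← Real.rpow_add_one hpos.ne']
    congr 1
    ring
  simp only [Function.comp_apply]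
  rw [h1]
  field_simp
  ring

theorem IsDensity.continuous_tailMass (hN : IsDensity N n D) (μ : ℝ) : Continuous (tailMass μ N) :=
  continuous_iff_continuousAt.2 fun y => (hasDerivAt_tailMass μ hN.continuous y).continuousAt

theorem IsDensity.profile_tailMass_pos (hN : IsDensity N n D) (H : IsTailProfile κ r a μ Z h e)
    {x y : ℝ} (hm : 0 < tailMass μ N x) (hy : y ≤ x) : 0 < h (tailMass μ N y) :=
  H.apply_pos (hm.trans_le (hN.tailMass_antitone μ hy))

theorem IsDensity.continuousOn_youngDefect (hN : IsDensity N n D)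
    (H : IsTailProfile κ r a μ Z h e) (hr : 0 < r) {x : ℝ} (hm : 0 < tailMass μ N x) :
    ContinuousOn (fun y => κ / 2 * (N y * youngDefect r (N y) (h (tailMass μ N y))))
      (Icc 0 x) := by
  have hNc := hN.continuous.continuousOn (s := Icc 0 x)
  have hhc : ContinuousOn (fun y => h (tailMass μ N y)) (Icc 0 x) :=
    (H.continuous.comp (hN.continuous_tailMass μ)).continuousOn
  exact continuousOn_const.mul (hNc.mul (((continuousOn_const.mul ((hNc.pow 2).mul
    (hhc.rpow_const fun y hy => Or.inl (hN.profile_tailMass_pos H hm hy.2).ne'))).sub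
    (hNc.rpow_const fun y hy => Or.inr hr.le)).add (continuousOn_const.mul
      (hhc.rpow_const fun y hy => Or.inr hr.le))))

/-- The calibration inequality on a bounded interval `(0, x)`, obtained by completing the square
`|v' + ½ N (h'/h) v|² ≥ 0` and integrating the exact derivative of the calibration. -/
theorem IsDensity.integral_youngDefect_le (hN : IsDensity N n D)
    (H : IsTailProfile κ r a μ Z h e) (hr : 0 < r) {x : ℝ} (hx : 0 ≤ x)
    (hm : 0 < tailMass μ N x) :
    ∫ y in 0..x, κ / 2 * (N y * youngDefect r (N y) (h (tailMass μ N y))) ≤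
      (∫ y in 0..x, (1 / 2 * D y - κ / 2 * (N y * N y ^ r))) +
        calibration κ r h e (N x) (tailMass μ N x) - calibration κ r h e (N 0) μ := by
  set m := tailMass μ N with hmdef
  have hmd : ∀ y, HasDerivAt m (-N y) y := hasDerivAt_tailMass μ hN.continuous
  have hmc : Continuous m := hN.continuous_tailMass μ
  have hmem : ∀ y ∈ Icc 0 x, m y ∈ Ioc 0 μ := fun y hy =>
    ⟨hm.trans_le (hN.tailMass_antitone μ hy.2), hN.tailMass_le hy.1⟩
  have hm0 : m 0 = μ := by simp [hmdef, tailMass]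
  set K : ℝ → ℝ := fun y => e (m y) / h (m y) with hK
  set K' : ℝ → ℝ := fun y => -(2 * r * κ * h (m y) ^ (r - 2) + K y ^ 2) * -N y with hK'
  have hKd : ∀ y ∈ Icc 0 x, HasDerivAt K (K' y) y := fun y hy =>
    H.hasDerivAt_ratio_comp (hmd y) (hmem y hy)
  have hKc : ContinuousOn K (Icc 0 x) := fun y hy => (hKd y hy).continuousAt.continuousWithinAt
  have hhc : Continuous fun y => h (m y) := H.continuous.comp hmc
  have hh2 : ContinuousOn (fun y => h (m y) ^ (r - 2)) (Icc 0 x) :=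
    hhc.continuousOn.rpow_const fun y hy => Or.inl (H.apply_pos (hmem y hy).1).ne'
  have hK'c : ContinuousOn K' (Icc 0 x) :=
    ((continuousOn_const.mul hh2).add (hKc.pow 2)).neg.mul hN.continuous.continuousOn.neg
  have hrc : ∀ {F : ℝ → ℝ}, Continuous F → Continuous fun y => F y ^ r := fun hF =>
    hF.rpow_const fun _ => Or.inr hr.le
  set Φ : ℝ → ℝ := fun y => ∫ t in 0..m y, h t ^ r with hΦ
  have hΦd : ∀ y, HasDerivAt Φ (h (m y) ^ r * -N y) y := fun y =>
    (H.hasDerivAt_potential hr (m y)).comp y (hmd y)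
  have hNac := hN.absolutelyContinuous x hx
  have hKac : AbsolutelyContinuousOnInterval K 0 x :=
    absolutelyContinuousOnInterval_of_hasDerivAt (by rwa [uIcc_of_le hx]) (by rwa [uIcc_of_le hx])
  have hΦac : AbsolutelyContinuousOnInterval Φ 0 x :=
    absolutelyContinuousOnInterval_of_hasDerivAt (fun y _ => hΦd y)
      ((hrc hhc).mul hN.continuous.neg).continuousOn
  set Ψ : ℝ → ℝ := fun y => 1 / 8 * (N y * N y * K y) - κ / 2 * (1 - r / 2) * Φ y with hΨ
  have hΨac : AbsolutelyContinuousOnInterval Ψ 0 x :=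
    (((hNac.mul hNac).mul hKac).const_mul (1 / 8)).sub (hΦac.const_mul (κ / 2 * (1 - r / 2)))
  have hΨcal : ∀ y, Ψ y = calibration κ r h e (N y) (m y) := fun y => by
    simp only [hΨ, calibration, hK, hΦ]
    ring
  have hD : IntervalIntegrable D volume 0 x := by
    rw [intervalIntegrable_iff_integrableOn_Ioc_of_le hx]
    exact hN.integrable_deriv.mono_set Ioc_subset_Ioi_self
  have hpot : IntervalIntegrable (fun y => κ / 2 * (N y * N y ^ r)) volume 0 x :=
    (continuous_const.mul (hN.continuous.mul (hrc hN.continuous))).intervalIntegrable _ _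
  have hYc : ContinuousOn (fun y => κ / 2 * (N y * youngDefect r (N y) (h (m y)))) (Icc 0 x) :=
    hN.continuousOn_youngDefect H hr hm
  have hle : ∫ y in 0..x, κ / 2 * (N y * youngDefect r (N y) (h (m y))) ≤
      ∫ y in 0..x, (1 / 2 * D y - κ / 2 * (N y * N y ^ r) + deriv Ψ y) := by
    refine intervalIntegral.integral_mono_ae_restrict hx (hYc.intervalIntegrable_of_Icc hx)
      (((hD.const_mul _).sub hpot).add hΨac.intervalIntegrable_deriv) ?_
    filter_upwards [ae_restrict_of_ae hN.hasDerivAt, ae_restrict_mem measurableSet_Icc,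
      ae_restrict_of_ae (Measure.ae_ne volume (0 : ℝ))] with y hy hyI hy0
    have hypos : 0 < y := lt_of_le_of_ne hyI.1 (Ne.symm hy0)
    have hnd := hy hypos
    have hder : HasDerivAt Ψ (1 / 8 * ((n y * N y + N y * n y) * K y + N y * N y * K' y) -
        κ / 2 * (1 - r / 2) * (h (m y) ^ r * -N y)) y :=
      (((hnd.mul hnd).mul (hKd y hyI)).const_mul _).sub ((hΦd y).const_mul _)
    rw [hder.deriv]
    have hq := hN.quadratic y hypos (1 / 2 * (N y * K y))
    simp only [hK', youngDefect]
    linear_combination (1 / 2) * hq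
  rw [intervalIntegral.integral_add ((hD.const_mul _).sub hpot) hΨac.intervalIntegrable_deriv,
    hΨac.integral_deriv_eq_sub, hΨcal, hΨcal, hm0] at hle
  linarith

/-- The lower bound for the energy, with the part of the Young defect coming from `(0, x₁)`. -/
theorem IsDensity.energy_lower_bound (hN : IsDensity N n D) (H : IsTailProfile κ r a μ Z h e)
    (hκ : 0 < κ) (hr : 0 < r) (hr2 : r < 2) (ha : 0 < a) (hμ : 0 < μ)
    (hmass : ∫ y in Ioi 0, N y = μ) {x₁ : ℝ} (hx₁ : 0 ≤ x₁) (hm₁ : 0 < tailMass μ N x₁) :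
    -(a * Z / 4) - κ / 2 * (1 - r / 2) * (∫ t in 0..μ, h t ^ r) +
        ∫ y in 0..x₁, κ / 2 * (N y * youngDefect r (N y) (h (tailMass μ N y))) ≤
      1 / 2 * (∫ y in Ioi 0, D y) - κ / 2 * (∫ y in Ioi 0, N y * N y ^ r) - a / 2 * N 0 := by
  have hZ := H.pos
  set S := (∫ y in Ioi 0, N y) + ∫ y in Ioi 0, D y with hS
  have hbd : ∀ y, 0 ≤ y → N y ≤ S := fun y hy => hN.bounded hy
  have hrc : Continuous fun y => N y ^ r := hN.continuous.rpow_const fun _ => Or.inr hr.le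
  have hNr : ∀ y, 0 ≤ y → N y * N y ^ r ≤ S ^ r * N y := fun y hy => by
    rw [mul_comm]
    exact mul_le_mul_of_nonneg_right (Real.rpow_le_rpow (hN.nonneg y) (hbd y hy) hr.le)
      (hN.nonneg y)
  have hi : IntegrableOn (fun y => N y * N y ^ r) (Ioi 0) := by
    refine (hN.integrable.const_mul (S ^ r)).mono'
      (hN.continuous.mul hrc).aestronglyMeasurable ?_
    filter_upwards [ae_restrict_mem measurableSet_Ioi] with y hy
    have h0 := hN.nonneg y
    rw [Real.norm_of_nonneg (by positivity)]
    exact hNr y (le_of_lt hy)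
  -- it suffices to bound the energy up to an error proportional to a small tail mass `ε`
  have key : ∀ ε, 0 < ε → ε ≤ tailMass μ N x₁ →
      -(a * Z / 4) - κ / 2 * (1 - r / 2) * (∫ t in 0..μ, h t ^ r) +
        ∫ y in 0..x₁, κ / 2 * (N y * youngDefect r (N y) (h (tailMass μ N y))) ≤
      1 / 2 * (∫ y in Ioi 0, D y) - κ / 2 * (∫ y in Ioi 0, N y * N y ^ r) - a / 2 * N 0 +
        κ / 2 * S ^ r * ε := by
    intro ε hε hε1
    have hmc := hN.continuous_tailMass μ
    have hlim : Filter.Tendsto (tailMass μ N) Filter.atTop (nhds 0) := by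
      have := (intervalIntegral_tendsto_integral_Ioi 0 hN.integrable Filter.tendsto_id).const_sub μ
      rwa [hmass, sub_self] at this
    obtain ⟨x, hx, hmx⟩ : ∃ x, x₁ ≤ x ∧ tailMass μ N x = ε := by
      obtain ⟨b, hb1, hb2⟩ :=
        ((hlim.eventually_lt_const hε).and (Filter.eventually_ge_atTop x₁)).exists
      obtain ⟨x, hx, hxe⟩ := intermediate_value_Icc' hb2 hmc.continuousOn ⟨hb1.le, hε1⟩
      exact ⟨x, hx.1, hxe⟩
    have hx0 : 0 ≤ x := hx₁.trans hx
    have hcal := hN.integral_youngDefect_le H hr hx0 (by rw [hmx]; exact hε)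
    have hmeq := hN.tailMass_eq hmass hx0
    rw [hmx] at hmeq hcal
    have hmx' : 0 < tailMass μ N x := hmx ▸ hε
    have hYc := hN.continuousOn_youngDefect (κ := κ) H hr hmx'
    have hYmono : ∫ y in 0..x₁, κ / 2 * (N y * youngDefect r (N y) (h (tailMass μ N y))) ≤
        ∫ y in 0..x, κ / 2 * (N y * youngDefect r (N y) (h (tailMass μ N y))) := by
      refine intervalIntegral.integral_mono_interval le_rfl hx₁ hx ?_
        (hYc.intervalIntegrable_of_Icc hx0)
      filter_upwards [ae_restrict_mem measurableSet_Ioc] with y hy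
      have := youngDefect_nonneg hr hr2 (hN.nonneg y) (hN.profile_tailMass_pos H hmx' hy.2)
      have := hN.nonneg y
      show 0 ≤ κ / 2 * (N y * youngDefect r (N y) (h (tailMass μ N y)))
      positivity
    have hDint : IntervalIntegrable D volume 0 x := by
      rw [intervalIntegrable_iff_integrableOn_Ioc_of_le hx0]
      exact hN.integrable_deriv.mono_set Ioc_subset_Ioi_self
    have hpint : IntervalIntegrable (fun y => κ / 2 * (N y * N y ^ r)) volume 0 x :=
      (continuous_const.mul (hN.continuous.mul hrc)).intervalIntegrable _ _
    rw [intervalIntegral.integral_sub (hDint.const_mul _) hpint,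
      intervalIntegral.integral_const_mul (1 / 2) D,
      intervalIntegral.integral_const_mul (κ / 2) fun y => N y * N y ^ r] at hcal
    have hDsplit := intervalIntegral.integral_Ioi_sub_Ioi hN.integrable_deriv hx0
    have hpsplit := intervalIntegral.integral_Ioi_sub_Ioi hi hx0
    have hptail : ∫ y in Ioi x, N y * N y ^ r ≤ S ^ r * ε := by
      rw [hmeq, ← integral_const_mul]
      exact setIntegral_mono_on (hi.mono_set (Ioi_subset_Ioi hx0))
        ((hN.integrableOn_Ioi hx0).const_mul _) measurableSet_Ioi fun y hy =>
          hNr y (hx0.trans (le_of_lt hy))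
    have hεμ : ε ∈ Ioc 0 μ := ⟨hε, hmx ▸ hN.tailMass_le hx0⟩
    -- the boundary term at `x` is controlled by the kinetic energy on `(x, ∞)`
    have hΨx : calibration κ r h e (N x) ε ≤ 1 / 2 * ∫ y in Ioi x, D y := by
      have h1 := hN.sq_le hx0 (by rw [← hmeq]; exact hε)
      rw [← hmeq] at h1
      have h2 := H.mul_deriv_le hκ hr hεμ
      have h3 := H.apply_pos hε
      have h4 : e ε / h ε ≤ 1 / ε := by
        rw [div_le_div_iff₀ h3 hε]
        linarith
      have h5 : 0 ≤ ∫ t in 0..ε, h t ^ r := intervalIntegral.integral_nonneg hε.le fun t ht =>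
        Real.rpow_nonneg (H.apply_nonneg ht.1) r
      have h6 : 0 ≤ κ / 2 * (1 - r / 2) * ∫ t in 0..ε, h t ^ r :=
        mul_nonneg (mul_nonneg (by positivity) (by linarith)) h5
      have h7 : 1 / 8 * N x ^ 2 * (e ε / h ε) ≤ 1 / 8 * N x ^ 2 * (1 / ε) := by gcongr
      have h8 : 1 / 8 * N x ^ 2 * (1 / ε) ≤ 1 / 2 * ∫ y in Ioi x, D y := by
        rw [mul_one_div, div_le_iff₀ hε]
        linarith
      rw [calibration]
      linarith
    have hΨ0 : -(a * Z / 4) - κ / 2 * (1 - r / 2) * (∫ t in 0..μ, h t ^ r) ≤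
        calibration κ r h e (N 0) μ - a / 2 * N 0 := by
      rw [calibration, H.deriv_mass ha hμ, H.map_mass]
      have : 1 / 8 * N 0 ^ 2 * (2 * a / Z) - a / 2 * N 0 + a * Z / 4 =
          a / (4 * Z) * (N 0 - Z) ^ 2 := by
        field_simp
        ring
      have h2 : 0 ≤ a / (4 * Z) * (N 0 - Z) ^ 2 := by positivity
      linarith
    have hκp := mul_le_mul_of_nonneg_left hptail (show 0 ≤ κ / 2 by positivity)
    linear_combination hΨ0 + hcal + hYmono + hΨx + hκp - (1 / 2) * hDsplit + (κ / 2) * hpsplit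
  have hS0 : 0 ≤ S := (hN.nonneg 0).trans (hbd 0 le_rfl)
  have hcont : Filter.Tendsto (fun ε => 1 / 2 * (∫ y in Ioi 0, D y) -
      κ / 2 * (∫ y in Ioi 0, N y * N y ^ r) - a / 2 * N 0 + κ / 2 * S ^ r * ε)
      (nhdsWithin 0 (Ioi 0)) (nhds (1 / 2 * (∫ y in Ioi 0, D y) -
      κ / 2 * (∫ y in Ioi 0, N y * N y ^ r) - a / 2 * N 0 + κ / 2 * S ^ r * 0)) :=
    (Continuous.tendsto (by fun_prop) 0).mono_left nhdsWithin_le_nhds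
  rw [mul_zero, add_zero] at hcont
  refine ge_of_tendsto hcont ?_
  filter_upwards [Ioc_mem_nhdsGT hm₁] with ε hε using key ε hε.1 hε.2

end Calibration

/-! ### The energy of the soliton -/

/-- A classical derivative on `[0, ∞)` is a weak derivative. -/
theorem isL2WeakDeriv_ofReal {𝕜 : Type*} [RCLike 𝕜] {f f' : ℝ → ℝ}
    (hf : ∀ x, 0 ≤ x → HasDerivAt f (f' x) x) (hf2 : MemLp f 2 halfLine)
    (hf'2 : MemLp f' 2 halfLine) :
    IsL2WeakDeriv (fun x => (f x : 𝕜)) fun x => (f' x : 𝕜) := by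
  refine ⟨hf'2.ofReal, fun φ hφ hφc hφs => ?_⟩
  obtain ⟨a, b, ha, hab, hK⟩ := exists_Icc_of_isCompact_subset_Ioi hφc hφs
  have hφ0 : ∀ x, x ∉ Icc a b → φ x = 0 := fun x hx =>
    image_eq_zero_of_notMem_tsupport fun h => hx (hK h)
  have hi1 : Integrable (fun x => deriv φ x • f x) halfLine :=
    (hf2.locallyIntegrable (by norm_num)).integrable_smul_left_of_hasCompactSupport
      (hφ.continuous_deriv (by simp)) hφc.deriv
  have hi2 : Integrable (fun x => φ x • f' x) halfLine :=
    (hf'2.locallyIntegrable (by norm_num)).integrable_smul_left_of_hasCompactSupport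
      hφ.continuous hφc
  have hd : ∀ x ∈ Ici (0 : ℝ),
      HasDerivAt (fun x => φ x * f x) (deriv φ x • f x + φ x • f' x) x := fun x hx =>
    ((hφ.differentiable (by simp) x).hasDerivAt).mul (hf x hx)
  have hlim : Filter.Tendsto (fun x => φ x * f x) Filter.atTop (nhds 0) := by
    refine tendsto_const_nhds.congr' ?_
    filter_upwards [Filter.eventually_gt_atTop b] with x hx
    rw [hφ0 x fun h => absurd h.2 (not_le.2 hx), zero_mul]
  have hint := integral_Ioi_of_hasDerivAt_of_tendsto' hd (hi1.add hi2) hlim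
  rw [hφ0 0 fun h => absurd h.1 (not_le.2 ha), zero_mul, sub_zero, integral_add hi1 hi2] at hint
  have hcast : ∀ s t : ℝ → ℝ, ∫ x, s x • (t x : 𝕜) ∂halfLine =
      ((∫ x, s x • t x ∂halfLine : ℝ) : 𝕜) := fun s t => by
    rw [← integral_ofReal]
    simp [RCLike.real_smul_eq_coe_mul]
  rw [hcast, hcast, eq_neg_of_add_eq_zero_left hint, RCLike.ofReal_neg]

section Energy

variable {𝕜 : Type*} [RCLike 𝕜] {p α μ : ℝ}

/-- The energy in terms of the density, with `κ = 2 / p`, `r = (p - 2) / 2` and `a = -α`. -/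
theorem energy_eq (hp : 2 < p) (v : ℝ → 𝕜) :
    energy p α v = 1 / 2 * (∫ x in Ioi 0, ‖weakDeriv v x‖ ^ 2) -
      2 / p / 2 * (∫ x in Ioi 0, ‖v (max x 0)‖ ^ 2 * (‖v (max x 0)‖ ^ 2) ^ ((p - 2) / 2)) -
      -α / 2 * ‖v (max 0 0)‖ ^ 2 := by
  have hpow : ∀ t : ℝ, 0 ≤ t → t ^ p = t ^ 2 * (t ^ 2) ^ ((p - 2) / 2) := by
    intro t ht
    rcases ht.eq_or_lt with rfl | ht'
    · rw [Real.zero_rpow (by linarith)]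
      simp
    · rw [← Real.rpow_two, ← Real.rpow_mul ht, ← Real.rpow_add ht']
      congr 1
      ring
  have hint : ∫ x, ‖v x‖ ^ p ∂halfLine =
      ∫ x in Ioi 0, ‖v (max x 0)‖ ^ 2 * (‖v (max x 0)‖ ^ 2) ^ ((p - 2) / 2) := by
    refine setIntegral_congr_fun measurableSet_Ioi fun x hx => ?_
    simp only [max_eq_left (le_of_lt (show 0 < x from hx))]
    exact hpow _ (norm_nonneg _)
  rw [energy, hint, max_self]
  ring

theorem integral_density {v : ℝ → 𝕜} (hv : v ∈ H1mass 𝕜 μ) :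
    ∫ x in Ioi 0, ‖v (max x 0)‖ ^ 2 = μ := by
  rw [← hv.2]
  refine setIntegral_congr_fun measurableSet_Ioi fun x hx => ?_
  simp only [max_eq_left (le_of_lt (show 0 < x from hx))]

/-- The soliton: the square root of the tail profile along its own tail mass `m`. It has finite
energy, and its energy equals the lower bound furnished by the calibration. -/
theorem IsTailProfile.soliton_energy {κ r a Z : ℝ} {h e m : ℝ → ℝ}
    (H : IsTailProfile κ r a μ Z h e) (hκ : 0 < κ) (hr : 0 < r) (ha : 0 < a) (hμ : 0 < μ)
    (hm0 : m 0 = μ) (hm : ∀ x, 0 ≤ x → m x ∈ Ioc 0 μ ∧ HasDerivAt m (-h (m x)) x)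
    (hmt : Filter.Tendsto m Filter.atTop (nhds 0)) :
    (fun x => (√(h (m x)) : 𝕜)) ∈ H1mass 𝕜 μ ∧
    1 / 2 * (∫ x in Ioi 0, ‖weakDeriv (fun x => (√(h (m x)) : 𝕜)) x‖ ^ 2) -
      κ / 2 * (∫ x in Ioi 0, h (m x) * h (m x) ^ r) - a / 2 * h (m 0) =
      -(a * Z / 4) - κ / 2 * (1 - r / 2) * (∫ t in 0..μ, h t ^ r) := by
  have hZ := H.pos
  have hpos : ∀ x, 0 ≤ x → 0 < h (m x) := fun x hx => H.apply_pos (hm x hx).1.1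
  have hle : ∀ x, 0 ≤ x → h (m x) ≤ Z := fun x hx => H.apply_le (hm x hx).1.2
  have hmc : ContinuousOn m (Ici 0) := fun x hx => (hm x hx).2.continuousAt.continuousWithinAt
  have hhc : ContinuousOn (fun x => h (m x)) (Ici 0) := H.continuous.comp_continuousOn hmc
  have hec : ContinuousOn (fun x => e (m x)) (Ici 0) := fun x hx =>
    ((H.hasDerivAt_deriv _ (hm x hx).1).comp x (hm x hx).2).continuousAt.continuousWithinAt
  set E := 2 * √(a ^ 2 + κ * Z ^ r) with hE
  have he : ∀ x, 0 ≤ x → 0 ≤ e (m x) ∧ e (m x) ≤ E := by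
    intro x hx
    rw [H.deriv_eq _ (Ioc_subset_Icc_self (hm x hx).1)]
    refine ⟨by positivity, ?_⟩
    have : 0 ≤ h (m x) ^ r := Real.rpow_nonneg (hpos x hx).le r
    rw [hE]
    gcongr
    linarith
  have hi : IntegrableOn (fun x => h (m x)) (Ioi 0) := by
    have := (integrableOn_Ioi_deriv_of_nonpos' (fun x hx => (hm x hx).2)
      (fun x hx => neg_nonpos.2 (hpos x (le_of_lt hx)).le) hmt).neg
    simpa only [Pi.neg_def, neg_neg] using this
  have hmass : ∫ x in Ioi 0, h (m x) = μ := by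
    have := integral_Ioi_of_hasDerivAt_of_tendsto' (fun x hx => (hm x hx).2) hi.neg hmt
    rw [integral_neg, hm0] at this
    linarith
  have hud : ∀ x, 0 ≤ x →
      HasDerivAt (fun x => √(h (m x))) (-(1 / 2 * e (m x) * √(h (m x)))) x := by
    intro x hx
    refine ((((H.hasDerivAt (m x)).comp x (hm x hx).2)).sqrt (hpos x hx).ne').congr_deriv ?_
    have h1 := Real.sqrt_pos.2 (hpos x hx)
    have h2 := Real.mul_self_sqrt (hpos x hx).le
    simp only [Function.comp_apply]
    field_simp
    linear_combination (e (m x)) * h2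
  have hae : ∀ {f : ℝ → ℝ}, ContinuousOn f (Ici 0) → AEStronglyMeasurable f halfLine :=
    fun hf => (hf.mono Ioi_subset_Ici_self).aestronglyMeasurable measurableSet_Ioi
  have huc : ContinuousOn (fun x => √(h (m x))) (Ici 0) := hhc.sqrt
  have hu2 : MemLp (fun x => √(h (m x))) 2 halfLine := by
    rw [memLp_two_iff_integrable_sq (hae huc)]
    refine hi.congr ?_
    filter_upwards [ae_restrict_mem measurableSet_Ioi] with x hx
    rw [Real.sq_sqrt (hpos x (le_of_lt hx)).le]
  have hkin : IntegrableOn (fun x => 1 / 4 * e (m x) ^ 2 * h (m x)) (Ioi 0) := by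
    refine (hi.const_mul (1 / 4 * E ^ 2)).mono'
      (hae ((continuousOn_const.mul (hec.pow 2)).mul hhc)) ?_
    filter_upwards [ae_restrict_mem measurableSet_Ioi] with x hx
    have hx0 : 0 ≤ x := le_of_lt hx
    have h1 := hpos x hx0
    obtain ⟨h2, h3⟩ := he x hx0
    rw [Real.norm_of_nonneg (by positivity)]
    gcongr
  have hsq : ∀ x, 0 ≤ x →
      (-(1 / 2 * e (m x) * √(h (m x)))) ^ 2 = 1 / 4 * e (m x) ^ 2 * h (m x) := by
    intro x hx
    have h2 := Real.sq_sqrt (hpos x hx).le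
    linear_combination (1 / 4 * e (m x) ^ 2) * h2
  have hu'2 : MemLp (fun x => -(1 / 2 * e (m x) * √(h (m x)))) 2 halfLine := by
    have hc : ContinuousOn (fun x => -(1 / 2 * e (m x) * √(h (m x)))) (Ici 0) :=
      ((continuousOn_const.mul hec).mul huc).neg
    rw [memLp_two_iff_integrable_sq (hae hc)]
    refine hkin.congr ?_
    filter_upwards [ae_restrict_mem measurableSet_Ioi] with x hx
    rw [hsq x (le_of_lt hx)]
  have hweak := isL2WeakDeriv_ofReal (𝕜 := 𝕜) hud hu2 hu'2
  have hH1 : MemH1 fun x => (√(h (m x)) : 𝕜) :=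
    ⟨RCLike.continuous_ofReal.comp_continuousOn huc, hu2.ofReal, ⟨_, hweak⟩⟩
  refine ⟨⟨hH1, ?_⟩, ?_⟩
  · rw [← hmass]
    refine setIntegral_congr_fun measurableSet_Ioi fun x hx => ?_
    simp only [RCLike.norm_ofReal, sq_abs]
    exact Real.sq_sqrt (hpos x (le_of_lt hx)).le
  · have hkin_eq : ∫ x in Ioi 0, ‖weakDeriv (fun x => (√(h (m x)) : 𝕜)) x‖ ^ 2 =
        ∫ x in Ioi 0, 1 / 4 * e (m x) ^ 2 * h (m x) := by
      refine integral_congr_ae ?_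
      filter_upwards [hH1.isL2WeakDeriv.ae_eq hweak, ae_restrict_mem measurableSet_Ioi] with x hx hx0
      rw [hx, RCLike.norm_ofReal, sq_abs, hsq x (le_of_lt hx0)]
    have hpot : IntegrableOn (fun x => h (m x) * h (m x) ^ r) (Ioi 0) := by
      refine (hi.const_mul (Z ^ r)).mono'
        (hae (hhc.mul (hhc.rpow_const fun x _ => Or.inr hr.le))) ?_
      filter_upwards [ae_restrict_mem measurableSet_Ioi] with x hx
      have h1 := hpos x (le_of_lt hx)
      rw [Real.norm_of_nonneg (by positivity), mul_comm]
      have := Real.rpow_le_rpow h1.le (hle x (le_of_lt hx)) hr.le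
      gcongr
    -- along the soliton, the energy density is the exact derivative of the calibration
    have hcal : ∀ x ∈ Ici (0 : ℝ), HasDerivAt (fun x => calibration κ r h e (h (m x)) (m x))
        (κ / 2 * (h (m x) * h (m x) ^ r) - 1 / 2 * (1 / 4 * e (m x) ^ 2 * h (m x))) x := by
      intro x hx
      obtain ⟨h1, h2⟩ := hm x hx
      have h3 := H.hasDerivAt_ratio_comp h2 h1
      have h4 := (H.hasDerivAt (m x)).comp x h2
      have h5 := (H.hasDerivAt_potential hr (m x)).comp x h2
      refine ((((h4.pow 2).const_mul (1 / 8)).mul h3).sub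
        (h5.const_mul (κ / 2 * (1 - r / 2)))).congr_deriv ?_
      have hne := (hpos x hx).ne'
      have hpow : h (m x) ^ (r - 2) = h (m x) ^ r / h (m x) ^ 2 := by
        rw [Real.rpow_sub (hpos x hx), Real.rpow_two]
      simp only [Function.comp_apply, Pi.pow_apply]
      rw [hpow]
      field_simp
      ring
    have hlim : Filter.Tendsto (fun x => calibration κ r h e (h (m x)) (m x)) Filter.atTop
        (nhds 0) := by
      have hht : Filter.Tendsto (fun x => h (m x)) Filter.atTop (nhds 0) := by
        have := (H.continuous.tendsto 0).comp hmt
        rwa [H.map_zero] at this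
      have h1 : Filter.Tendsto (fun x => 1 / 8 * h (m x) ^ 2 * (e (m x) / h (m x))) Filter.atTop
          (nhds 0) := by
        refine squeeze_zero' (g := fun x => 1 / 8 * E * h (m x)) ?_ ?_ ?_
        · filter_upwards [Filter.eventually_ge_atTop 0] with x hx
          have h1 := hpos x hx
          have h2 := (he x hx).1
          positivity
        · filter_upwards [Filter.eventually_ge_atTop 0] with x hx
          have h1 := hpos x hx
          have h2 := (he x hx).2
          have h3 : 1 / 8 * h (m x) ^ 2 * (e (m x) / h (m x)) = 1 / 8 * e (m x) * h (m x) := by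
            field_simp
          rw [h3]
          gcongr
        · simpa using hht.const_mul (1 / 8 * E)
      have h2 : Filter.Tendsto (fun x => ∫ t in 0..m x, h t ^ r) Filter.atTop (nhds 0) := by
        have := ((H.hasDerivAt_potential hr 0).continuousAt.tendsto).comp hmt
        rwa [intervalIntegral.integral_same] at this
      simpa [calibration] using h1.sub (h2.const_mul (κ / 2 * (1 - r / 2)))
    have hint := integral_Ioi_of_hasDerivAt_of_tendsto' hcal
      ((hpot.const_mul _).sub (hkin.const_mul _)) hlim
    rw [integral_sub (hpot.const_mul _) (hkin.const_mul _), integral_const_mul,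
      integral_const_mul, hm0, H.map_mass, calibration, H.deriv_mass ha hμ, H.map_mass] at hint
    have hbdry : 1 / 8 * Z ^ 2 * (2 * a / Z) = a * Z / 4 := by
      field_simp
      ring
    rw [hbdry] at hint
    rw [hkin_eq, hm0, H.map_mass]
    linarith

end Energy

end HalfLineNLS

/-! ### Existence and uniqueness of the ground state -/

open HalfLineNLS in
theorem theorem1p1 {𝕜 : Type*} [RCLike 𝕜] (p α μ : ℝ) (hp : 2 < p) (hp' : p < 6)
    (hα : α < 0) (hμ : 0 < μ) :
    ∃ u : ℝ → 𝕜, HalfLineNLS.IsGroundState p α μ u ∧ HalfLineNLS.PositiveOn u (Set.Ici 0) ∧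
      ∀ v : ℝ → 𝕜, HalfLineNLS.IsGroundState p α μ v → HalfLineNLS.PositiveOn v (Set.Ioi 0) →
        Set.EqOn v u (Set.Ici 0) := by
  have hκ : 0 < 2 / p := by positivity
  have hr : 0 < (p - 2) / 2 := by linarith
  have hr2 : (p - 2) / 2 < 2 := by linarith
  have ha : 0 < -α := by linarith
  obtain ⟨Z, h, e, H⟩ := exists_isTailProfile hκ hr hr2 ha hμ
  obtain ⟨m, hm0, hm, hmt⟩ := H.exists_tailMass hκ hr ha
  obtain ⟨hu, huE⟩ := H.soliton_energy (𝕜 := 𝕜) hκ hr ha hμ hm0 hm hmt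
  have hpos : ∀ x, 0 ≤ x → 0 < h (m x) := fun x hx => H.apply_pos (hm x hx).1.1
  have hEu : energy p α (fun x => (√(h (m x)) : 𝕜)) = -(-α * Z / 4) -
      2 / p / 2 * (1 - (p - 2) / 2 / 2) * (∫ t in 0..μ, h t ^ ((p - 2) / 2)) := by
    rw [energy_eq hp, ← huE]
    have hden : ∀ x, 0 ≤ x → ‖(√(h (m (max x 0))) : 𝕜)‖ ^ 2 = h (m x) := fun x hx => by
      rw [max_eq_left hx, RCLike.norm_ofReal, sq_abs, Real.sq_sqrt (hpos x hx).le]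
    have hpot : ∫ x in Ioi 0, ‖(√(h (m (max x 0))) : 𝕜)‖ ^ 2 *
        (‖(√(h (m (max x 0))) : 𝕜)‖ ^ 2) ^ ((p - 2) / 2) =
        ∫ x in Ioi 0, h (m x) * h (m x) ^ ((p - 2) / 2) :=
      setIntegral_congr_fun measurableSet_Ioi fun x hx => by simp only [hden x (le_of_lt hx)]
    rw [hden 0 le_rfl, hpot]
  refine ⟨fun x => (√(h (m x)) : 𝕜), ⟨hu, fun v hv => ?_⟩,
    fun x hx => ⟨_, Real.sqrt_pos.2 (hpos x hx), rfl⟩, fun v hv hvpos => ?_⟩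
  · have hN := hv.1.isDensity
    have hbound := hN.energy_lower_bound H hκ hr hr2 ha hμ (integral_density hv) le_rfl
      (by simpa [tailMass] using hμ)
    rw [intervalIntegral.integral_same, add_zero] at hbound
    show energy p α _ ≤ energy p α v
    rw [hEu, energy_eq hp v]
    exact hbound
  · have hN := hv.1.1.isDensity
    set N : ℝ → ℝ := fun x => ‖v (max x 0)‖ ^ 2 with hNdef
    have hmassN : ∫ x in Ioi 0, N x = μ := integral_density hv.1
    have hNpos : ∀ x, 0 < x → 0 < N x := by
      intro x hx
      obtain ⟨t, ht, hvt⟩ := hvpos x hx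
      simp only [hNdef, max_eq_left hx.le, hvt, RCLike.norm_ofReal, sq_abs]
      positivity
    have htail : ∀ x, 0 ≤ x → 0 < tailMass μ N x := by
      intro x hx
      rw [hN.tailMass_eq hmassN hx, setIntegral_pos_iff_support_of_nonneg_ae
        (Filter.Eventually.of_forall hN.nonneg) (hN.integrableOn_Ioi hx)]
      have hsub : Ioi x ⊆ Function.support N ∩ Ioi x := fun y hy =>
        ⟨(hNpos y (hx.trans_lt hy)).ne', hy⟩
      exact lt_of_lt_of_le (by simp) (measure_mono hsub)
    have hEv : energy p α v ≤ energy p α (fun x => (√(h (m x)) : 𝕜)) := hv.2 hu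
    -- the Young defect of a minimizer vanishes
    have hNh : ∀ x ∈ Ioi (0 : ℝ), N x = h (tailMass μ N x) := by
      intro x hx
      have hx0 : 0 ≤ x := le_of_lt hx
      have hhpos : ∀ y, y ≤ x → 0 < h (tailMass μ N y) := fun y hy =>
        hN.profile_tailMass_pos H (htail x hx0) hy
      have hY : ∀ y, y ≤ x →
          0 ≤ 2 / p / 2 * (N y * youngDefect ((p - 2) / 2) (N y) (h (tailMass μ N y))) :=
        fun y hy => mul_nonneg (by positivity)
          (mul_nonneg (hN.nonneg y) (youngDefect_nonneg hr hr2 (hN.nonneg y) (hhpos y hy)))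
      have hbound := hN.energy_lower_bound H hκ hr hr2 ha hμ hmassN hx0 (htail x hx0)
      rw [hEu, energy_eq hp v] at hEv
      have hle := (add_le_iff_nonpos_right _).1 (hbound.trans hEv)
      refine eq_of_youngDefect_eq_zero hr hr2 (hN.nonneg x) (hhpos x le_rfl) ?_
      by_contra hne
      refine not_lt.2 hle (intervalIntegral.integral_pos hx
        (hN.continuousOn_youngDefect H hr (htail x hx0)) (fun y hy => hY y hy.2)
        ⟨x, ⟨hx0, le_rfl⟩, lt_of_le_of_ne (hY x le_rfl) (Ne.symm ?_)⟩)
      exact mul_ne_zero (by positivity) (mul_ne_zero (hNpos x hx).ne' hne)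
    have hNh' : ∀ x ∈ Ici (0 : ℝ), N x = h (tailMass μ N x) := by
      rw [← closure_Ioi (0 : ℝ)]
      exact closure_minimal hNh
        (isClosed_eq hN.continuous (H.continuous.comp (hN.continuous_tailMass μ)))
    -- both tail masses solve `m' = -h(m)`, `m(0) = μ`
    have htails : ∀ x, 0 ≤ x → tailMass μ N x = m x := by
      intro x hx
      obtain ⟨K, hK⟩ := H.lipschitz
      refine ODE_solution_unique (v := fun _ τ => -h τ) (fun _ => hK.neg)
        (hN.continuous_tailMass μ).continuousOn (fun t ht => ?_)
        (fun t ht => (hm t ht.1).2.continuousAt.continuousWithinAt)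
        (fun t ht => (hm t ht.1).2.hasDerivWithinAt) ?_ (⟨hx, le_rfl⟩ : x ∈ Icc 0 x)
      · rw [← hNh' t ht.1]
        exact (hasDerivAt_tailMass μ hN.continuous t).hasDerivWithinAt
      · rw [hm0]
        simp [tailMass]
    have heq : EqOn v (fun x => (√(h (m x)) : 𝕜)) (Ioi 0) := by
      intro x hx
      have hx0 : 0 ≤ x := le_of_lt hx
      obtain ⟨t, ht, hvt⟩ := hvpos x hx
      have h1 := hNh x hx
      rw [htails x hx0] at h1
      simp only [hNdef, max_eq_left hx0, hvt, RCLike.norm_ofReal, sq_abs] at h1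
      simp only [hvt, ← h1, Real.sqrt_sq ht.le]
    exact heq.of_subset_closure hv.1.1.continuousOn hu.1.continuousOn Ioi_subset_Ici_self
      (closure_Ioi (0 : ℝ)).ge
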